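/- Let $\theta>0$ and $0<H\le 3/4$. Let $S^H=(S^H_t)_{t\ge 0}$ be a sub-fractional Brownian motion with parameter $H$, i.e. a centered Gaussian process with continuous paths and covariance $E[S^H_sS^H_t]=t^{2H}+s^{2H}-\frac12\big((t+s)^{2H}+|t-s|^{2H}\big)$, and let $X=(X_t)_{t\ge0}$ be the continuous solution of $dX_t=-\theta X_t\,dt+dS^H_t$, $X_0=0$, i.e. $X_t=S^H_t-\theta\int_0^tX_s\,ds$. For $n\ge1$ put $$V_n(X)=\frac1{\sqrt n}\sum_{i=1}^n\big(X_i^2-E[X_i^2]\big).$$ Let $Z_t=e^{-\theta t}\int_{-\infty}^te^{\theta u}\,dB^H_u$, $t\in\mathbb R$, be the stationary fractional Ornstein-Uhlenbeck process, where $B^H$ is a two-sided fractional Brownian motion of Hurst parameter $H$, and put $\rho_H(k)=E[Z_kZ_0]$ for $k\in\mathbb Z$. Let $\psi_H(n)=n^{-1}$ if $0<H<1/2$ and $\psi_H(n)=n^{4H-3}$ if $1/2\le H<3/4$. (a) Suppose $0<H<3/4$. Then $\rho_H(0)=H\Gamma(2H)/\theta^{2H}$, the series in $$\sigma_H^2:=2\rho_H(0)^2+2\sum_{i\in\mathbb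 Z\setminus\{0\}}\rho_H(i)^2$$ converges, and there is a constant $C>0$ depending only on $H$ and $\theta$ such that for all $n\ge1$ $$\big|E[V_n(X)^2]-\sigma_H^2\big|\le C\,\psi_H(n).$$ In particular $E[V_n(X)^2]\to\sigma_H^2>0$ as $n\to\infty$, which is hypothesis $(\mathcal H2)$: $E[V_n(X)^2]$ converges to a positive limit. (b) Suppose $H=3/4$. Then there is a constant $C>0$ depending only on $\theta$ such that for all $n\ge2$ $$\left|\frac{E[V_n(X)^2]}{\log n}-\frac{9}{16\,\theta^4}\right|\le\frac{C}{\log n};$$ in particular $E[V_n(X)^2]/\log n\to 9/(16\theta^4)$. -/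

import Mathlib

open MeasureTheory ProbabilityTheory Filter Topology
open scoped NNReal

universe u v

noncomputable section

namespace SubFracOU

/-- Covariance of the sub-fractional Brownian motion,
`t^{2H} + s^{2H} - ((t+s)^{2H} + |t-s|^{2H}) / 2`. -/
def subFracCov (H s t : ℝ) : ℝ :=
  t ^ (2 * H) + s ^ (2 * H) - (1 / 2) * ((t + s) ^ (2 * H) + |t - s| ^ (2 * H))

/-- Covariance of the two-sided fractional Brownian motion. -/
def fracCov (H s t : ℝ) : ℝ :=
  (1 / 2) * (|t| ^ (2 * H) + |s| ^ (2 * H) - |t - s| ^ (2 * H))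

/-- `S = (S_t)_{t ≥ 0}` is a sub-fractional Brownian motion of parameter `H`: a centered Gaussian
process with covariance `subFracCov H` and almost surely continuous paths. -/
structure IsSubFracBM {Ω : Type*} [MeasurableSpace Ω] (H : ℝ) (S : ℝ≥0 → Ω → ℝ)
    (μ : Measure Ω) : Prop where
  gaussian : IsGaussianProcess S μ
  mean_zero : ∀ t, ∫ ω, S t ω ∂μ = 0
  covariance : ∀ s t, ∫ ω, S s ω * S t ω ∂μ = subFracCov H s t
  continuous_paths : ∀ᵐ ω ∂μ, Continuous fun t => S t ω

/-- `B = (B_t)_{t ∈ ℝ}` is a two-sided fractional Brownian motion of Hurst parameter `H`. -/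
structure IsFracBM {Ω : Type*} [MeasurableSpace Ω] (H : ℝ) (B : ℝ → Ω → ℝ)
    (μ : Measure Ω) : Prop where
  gaussian : IsGaussianProcess B μ
  mean_zero : ∀ t, ∫ ω, B t ω ∂μ = 0
  covariance : ∀ s t, ∫ ω, B s ω * B t ω ∂μ = fracCov H s t
  continuous_paths : ∀ᵐ ω ∂μ, Continuous fun t => B t ω

/-- `X` is the continuous solution of `dX_t = -θ X_t dt + dG_t`, `X_0 = 0`, in integral form
`X_t = G_t - θ ∫_0^t X_s ds` for all `t ≥ 0` (the driving processes used below vanish at time `0`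
almost surely). -/
structure IsOUSolution {Ω : Type*} [MeasurableSpace Ω] (θ : ℝ) (G X : ℝ≥0 → Ω → ℝ)
    (μ : Measure Ω) : Prop where
  continuous_paths : ∀ᵐ ω ∂μ, Continuous fun t => X t ω
  initial : ∀ᵐ ω ∂μ, X 0 ω = 0
  equation : ∀ᵐ ω ∂μ, ∀ t : ℝ≥0,
    X t ω = G t ω - θ * ∫ s in (0 : ℝ)..t, X s.toNNReal ω

/-- `I` is the Riemann-Stieltjes (Young) integral `∫_a^b f dg`: the limit of the sums
`∑ f(τ_i) (g(p_{i+1}) - g(p_i))` over tagged partitions of `[a, b]` as the mesh tends to `0`. -/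
def IsStieltjesIntegral (f g : ℝ → ℝ) (a b I : ℝ) : Prop :=
  ∀ ε > 0, ∃ δ > 0, ∀ (n : ℕ) (p τ : ℕ → ℝ), p 0 = a → p n = b →
    (∀ i < n, p i ≤ τ i ∧ τ i ≤ p (i + 1) ∧ p (i + 1) - p i < δ) →
    |∑ i ∈ Finset.range n, f (τ i) * (g (p (i + 1)) - g (p i)) - I| < ε

/-- `Z_t = e^{-θ t} ∫_{-∞}^t e^{θ u} dB_u` almost surely, for every `t`, the integral over
`(-∞, t]` being the limit of the integrals over `[T, t]` as `T → -∞`. -/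
def IsStationaryOU {Ω : Type*} [MeasurableSpace Ω] (θ : ℝ) (B Z : ℝ → Ω → ℝ)
    (μ : Measure Ω) : Prop :=
  ∀ t : ℝ, ∀ᵐ ω ∂μ, ∃ I : ℝ → ℝ,
    (∀ T ≤ t, IsStieltjesIntegral (fun u => Real.exp (θ * u)) (fun u => B u ω) T t (I T)) ∧
    Tendsto (fun T => Real.exp (-θ * t) * I T) atBot (𝓝 (Z t ω))

/-- `V_n(X) = n^{-1/2} ∑_{i=1}^n (X_i² - E[X_i²])`. -/
def quadVar {Ω : Type*} [MeasurableSpace Ω] (X : ℝ≥0 → Ω → ℝ) (μ : Measure Ω) (n : ℕ)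
    (ω : Ω) : ℝ :=
  (1 / √(n : ℝ)) * ∑ i ∈ Finset.Icc 1 n, (X (i : ℝ≥0) ω ^ 2 - ∫ ω', X (i : ℝ≥0) ω' ^ 2 ∂μ)

/-- `v_n = E[V_n(X)²]`. -/
def quadVarVariance {Ω : Type*} [MeasurableSpace Ω] (X : ℝ≥0 → Ω → ℝ) (μ : Measure Ω)
    (n : ℕ) : ℝ :=
  ∫ ω, quadVar X μ n ω ^ 2 ∂μ

/-- The hypothesis (H2): `E[V_n(X)²]` converges to some `σ² > 0`. -/
def HypothesisH2 {Ω : Type*} [MeasurableSpace Ω] (X : ℝ≥0 → Ω → ℝ) (μ : Measure Ω) : Prop :=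
  ∃ σsq : ℝ, 0 < σsq ∧ Tendsto (quadVarVariance X μ) atTop (𝓝 σsq)

/-- `ρ(k) = E[Z_k Z_0]`, `k ∈ ℤ`. -/
def autoCov {Ω : Type*} [MeasurableSpace Ω] (Z : ℝ → Ω → ℝ) (μ : Measure Ω) (k : ℤ) : ℝ :=
  ∫ ω, Z k ω * Z 0 ω ∂μ

/-- `2 ρ(0)² + 2 ∑_{i ∈ ℤ \ {0}} ρ(i)²`. -/
def asympVar (ρ : ℤ → ℝ) : ℝ :=
  2 * ρ 0 ^ 2 + 2 * ∑' i : {i : ℤ // i ≠ 0}, ρ i ^ 2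

/-- `f_H(θ) = H Γ(2H) / θ^{2H}`. -/
def limitVar (H θ : ℝ) : ℝ := H * Real.Gamma (2 * H) / θ ^ (2 * H)

/-- `ψ_α(n) = n^{-1}` if `α < 1/2`, and `n^{4α-3}` if `1/2 ≤ α (< 3/4)`. -/
def rate (α : ℝ) (n : ℕ) : ℝ :=
  if α < 1 / 2 then (n : ℝ)⁻¹ else (n : ℝ) ^ (4 * α - 3)

end SubFracOU

end

/-! For jointly centered Gaussian variables, Cov(Y², W²) = 2 E[YW]². Hence E[V_n(X)²] = (2/n) ∑_{i,j
≤ n} E[X_i X_j]² (`IsGaussianSpace.quadVarVariance_eq`), and everything reduces to the covariance of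
X.

Integrated by parts, ∫_T^t e^{-θ(t-u)} dG_u is a linear functional of the path (`ouFunctional`).
Over an infinite past it is the mean of G_t - G_{t-ξ} for an exponential ξ of rate θ; a finite T
adds a boundary term with factor e^{-θ(t-T)} (`ouFunctional_eq`). Applied in both variables to a
covariance kernel, it annihilates functions of one variable and turns |t-s|^α and |s+t|^α, α = 2H,
into the averaged second differences `statCov` and `sumCov` (`ouFunctional_ouFunctional`). So E[Z_s
Z_t] = `statCov` at t-s, the boundary terms dying as T → -∞, while E[X_s X_t] is the same quantity
plus `covDeviation`.

A Taylor expansion shows that the two functions are ±α(α-1)/(2θ²) w^{α-2} + O(w^{α-3}). With γ =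
2-2H, `statCov` is therefore O((k+1)^{-γ}) and the deviation is O((i+j+1)^{-γ}) (`exists_decay`). At
H = 1/2 the leading coefficient vanishes and γ = 2 is available. In the double sum of squares the
deviation costs O((∑_{k≤n} k^{-γ})²) (`exists_sum_sum_abs_sub_le`), and replacing the stationary
double sum by n times its full series costs O(∑_{k≤n} k^{1-2γ}) (`abs_sum_sum_sub_le`). Both are O(n
ψ_H(n)) when H < 3/4 (`exists_exponent`).

At H = 3/4 the squared stationary covariance is c²/k + O(k^{-2}) with 4c² = 9/(16θ⁴). The double sum
then contains a sum of harmonic numbers, of size n log n, and everything else is O(n)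
(`exists_log_bound`). -/

namespace SubFracOU

/-! ### Gaussian spaces, their almost sure limits, and Isserlis' formula -/

section GaussianSpaces

variable {Ω : Type*} [MeasurableSpace Ω] {μ : Measure Ω}

/-- A real random variable with a centered Gaussian law. -/
structure IsCenteredGaussian (Y : Ω → ℝ) (μ : Measure Ω) : Prop where
  law : HasGaussianLaw Y μ
  mean_zero : ∫ ω, Y ω ∂μ = 0

namespace IsCenteredGaussian

variable {Y : Ω → ℝ}

lemma memLp (h : IsCenteredGaussian Y μ) {p : ENNReal} (hp : p ≠ ⊤) : MemLp Y p μ :=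
  h.law.memLp hp

lemma integrable_pow (h : IsCenteredGaussian Y μ) (n : ℕ) : Integrable (fun ω => Y ω ^ n) μ := by
  have := h.law.isProbabilityMeasure
  rcases Nat.eq_zero_or_pos n with rfl | hn
  · simp
  · have h1 := (h.memLp (p := n) (by simp)).integrable_norm_pow (by omega)
    refine h1.mono (h.law.aemeasurable.pow_const n).aestronglyMeasurable ?_
    exact Eventually.of_forall fun ω => by simp

lemma variance_eq (h : IsCenteredGaussian Y μ) : Var[Y; μ] = ∫ ω, Y ω ^ 2 ∂μ := by
  rw [variance_of_integral_eq_zero h.law.aemeasurable h.mean_zero]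

lemma map_eq (h : IsCenteredGaussian Y μ) :
    μ.map Y = gaussianReal 0 (∫ ω, Y ω ^ 2 ∂μ).toNNReal := by
  rw [h.law.map_eq_gaussianReal, h.variance_eq, h.mean_zero]

lemma of_map_eq {v : ℝ≥0} (hY : AEMeasurable Y μ) (h : μ.map Y = gaussianReal 0 v) :
    IsCenteredGaussian Y μ where
  law := ⟨by rw [h]; infer_instance⟩
  mean_zero := by
    have h1 : ∫ x, x ∂(μ.map Y) = 0 := by rw [h, integral_id_gaussianReal]
    rwa [integral_map hY (by fun_prop)] at h1

lemma charFun_eq (h : IsCenteredGaussian Y μ) (t : ℝ) :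
    charFun (μ.map Y) t = Complex.exp (-(((∫ ω, Y ω ^ 2 ∂μ) * t ^ 2 / 2 : ℝ) : ℂ)) := by
  rw [h.map_eq, charFun_gaussianReal]
  have : (0 : ℝ) ≤ ∫ ω, Y ω ^ 2 ∂μ := integral_nonneg fun ω => sq_nonneg _
  congr 1
  rw [Real.coe_toNNReal _ this]
  push_cast
  ring

end IsCenteredGaussian

lemma iteratedDeriv_four_exp_mul_sq (v : ℝ) :
    iteratedDeriv 4 (fun t : ℝ => Real.exp (v * t ^ 2 / 2)) 0 = 3 * v ^ 2 := by
  have h0 (t : ℝ) : HasDerivAt (fun t : ℝ => Real.exp (v * t ^ 2 / 2))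
      (Real.exp (v * t ^ 2 / 2) * (v * t)) t := by
    have := (((hasDerivAt_id t).pow 2).const_mul v).div_const 2
    refine this.exp.congr_deriv ?_
    simp
    ring
  have hp {p : ℝ → ℝ} {p' : ℝ} {t : ℝ} (h : HasDerivAt p p' t) :
      HasDerivAt (fun t : ℝ => Real.exp (v * t ^ 2 / 2) * p t)
        (Real.exp (v * t ^ 2 / 2) * (v * t * p t + p')) t := by
    refine ((h0 t).mul h).congr_deriv ?_
    ring
  have d1 : deriv (fun t : ℝ => Real.exp (v * t ^ 2 / 2)) =
      fun t => Real.exp (v * t ^ 2 / 2) * (v * t) := funext fun t => (h0 t).deriv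
  have d2 : deriv (fun t : ℝ => Real.exp (v * t ^ 2 / 2) * (v * t)) =
      fun t => Real.exp (v * t ^ 2 / 2) * (v * t * (v * t) + v) := funext fun t =>
    (hp (by simpa using (hasDerivAt_id t).const_mul v)).deriv
  have d3 : deriv (fun t : ℝ => Real.exp (v * t ^ 2 / 2) * (v * t * (v * t) + v)) =
      fun t => Real.exp (v * t ^ 2 / 2) *
        (v * t * (v * t * (v * t) + v) + 2 * v ^ 2 * t) := funext fun t => by
    refine (hp ?_).deriv
    have h1 : HasDerivAt (fun t : ℝ => v * t) v t := by
      simpa using (hasDerivAt_id t).const_mul v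
    refine ((h1.mul h1).add_const v).congr_deriv ?_
    ring
  have d4 : deriv (fun t : ℝ => Real.exp (v * t ^ 2 / 2) *
        (v * t * (v * t * (v * t) + v) + 2 * v ^ 2 * t)) 0 = 3 * v ^ 2 := by
    have h1 : HasDerivAt (fun t : ℝ => v * t) v 0 := by
      simpa using (hasDerivAt_id (0 : ℝ)).const_mul v
    have h2 : HasDerivAt (fun t : ℝ => 2 * v ^ 2 * t) (2 * v ^ 2) 0 := by
      simpa using (hasDerivAt_id (0 : ℝ)).const_mul (2 * v ^ 2)
    refine (hp (p := fun t => v * t * (v * t * (v * t) + v) + 2 * v ^ 2 * t)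
      ((h1.mul ((h1.mul h1).add_const v)).add h2)).deriv.trans ?_
    simp
    ring
  simp only [iteratedDeriv_succ, iteratedDeriv_zero, d1, d2, d3, d4]

/-- The fourth moment is the fourth derivative at 0 of the moment generating function exp(v t²/2).
-/
lemma integral_pow_four_gaussianReal (v : ℝ≥0) :
    ∫ x, x ^ 4 ∂(gaussianReal 0 v) = 3 * (v : ℝ) ^ 2 := by
  have h := iteratedDeriv_mgf_zero (X := id) (μ := gaussianReal 0 v)
    (by simp [integrableExpSet_id_gaussianReal]) 4
  rw [mgf_id_gaussianReal] at h
  simp only [zero_mul, zero_add, iteratedDeriv_four_exp_mul_sq] at h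
  simpa using h.symm

namespace IsCenteredGaussian

variable {Y : Ω → ℝ}

lemma integral_pow_four (h : IsCenteredGaussian Y μ) :
    ∫ ω, Y ω ^ 4 ∂μ = 3 * (∫ ω, Y ω ^ 2 ∂μ) ^ 2 := by
  have h1 := integral_pow_four_gaussianReal (∫ ω, Y ω ^ 2 ∂μ).toNNReal
  rw [← h.map_eq, integral_map h.law.aemeasurable (by fun_prop),
    Real.coe_toNNReal _ (integral_nonneg fun ω => sq_nonneg _)] at h1
  exact h1

/-- Almost sure limits of centered Gaussian variables are centered Gaussian, and the variances
converge. -/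
lemma of_tendsto [IsProbabilityMeasure μ] {Z : ℕ → Ω → ℝ}
    (hZ : ∀ m, IsCenteredGaussian (Z m) μ)
    (hlim : ∀ᵐ ω ∂μ, Tendsto (fun m => Z m ω) atTop (𝓝 (Y ω))) :
    IsCenteredGaussian Y μ ∧
      Tendsto (fun m => ∫ ω, Z m ω ^ 2 ∂μ) atTop (𝓝 (∫ ω, Y ω ^ 2 ∂μ)) := by
  have hYm : AEMeasurable Y μ :=
    aemeasurable_of_tendsto_metrizable_ae atTop (fun m => (hZ m).law.aemeasurable) hlim
  have hchar (W : Ω → ℝ) (hW : AEMeasurable W μ) (t : ℝ) :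
      charFun (μ.map W) t = ∫ ω, Complex.exp (t * W ω * Complex.I) ∂μ := by
    rw [charFun_apply_real, integral_map hW (by fun_prop)]
  have hconv (t : ℝ) : Tendsto (fun m => charFun (μ.map (Z m)) t) atTop
      (𝓝 (charFun (μ.map Y) t)) := by
    simp_rw [hchar Y hYm, fun m => hchar (Z m) (hZ m).law.aemeasurable]
    refine tendsto_integral_of_dominated_convergence (fun _ => 1) (fun m => ?_) (by simp)
      (fun m => Eventually.of_forall fun ω => ?_) ?_
    · have := (hZ m).law.aemeasurable
      exact AEMeasurable.aestronglyMeasurable (by fun_prop)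
    · rw [show (t : ℂ) * (Z m ω : ℂ) * Complex.I = ((t * Z m ω : ℝ) : ℂ) * Complex.I by
        push_cast; ring, Complex.norm_exp_ofReal_mul_I]
    · filter_upwards [hlim] with ω hω
      have hc : Continuous fun x : ℝ => Complex.exp (t * x * Complex.I) := by fun_prop
      exact (hc.tendsto _).comp hω
  have : IsProbabilityMeasure (μ.map Y) := Measure.isProbabilityMeasure_map hYm
  -- The limit characteristic function equals 1 at 0 and is continuous, hence is nonzero at some s >
  -- 0. There |φ_m(s)| = exp(-w_m s²/2) can be inverted by the logarithm, so the variances w_m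
  -- converge; no uniform integrability is needed.
  obtain ⟨s, hs0, hs⟩ : ∃ s : ℝ, 0 < s ∧ charFun (μ.map Y) s ≠ 0 := by
    have hc : ContinuousAt (charFun (μ.map Y)) 0 := continuous_charFun.continuousAt
    have h0 : charFun (μ.map Y) 0 ≠ 0 := by simp
    have h1 := hc.eventually_ne h0
    obtain ⟨ε, hε, hb⟩ := Metric.eventually_nhds_iff.1 h1
    exact ⟨ε / 2, by positivity, hb (by simp [abs_of_pos hε]; linarith)⟩
  set w : ℕ → ℝ := fun m => ∫ ω, Z m ω ^ 2 ∂μ with hw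
  have hnorm : Tendsto (fun m => Real.exp (-(w m * s ^ 2 / 2))) atTop
      (𝓝 ‖charFun (μ.map Y) s‖) := by
    refine (hconv s).norm.congr fun m => ?_
    rw [(hZ m).charFun_eq, ← Complex.ofReal_neg, Complex.norm_exp_ofReal]
  have hlog := (Real.continuousAt_log (norm_ne_zero_iff.2 hs)).tendsto.comp hnorm
  set L := Real.log ‖charFun (μ.map Y) s‖
  have hwlim : Tendsto w atTop (𝓝 (-(2 / s ^ 2) * L)) := by
    refine (hlog.const_mul (-(2 / s ^ 2))).congr fun m => ?_
    simp only [Function.comp, Real.log_exp]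
    field_simp
  set v := -(2 / s ^ 2) * L
  have hv : 0 ≤ v := ge_of_tendsto' hwlim fun m => integral_nonneg fun ω => sq_nonneg _
  -- Once w_m → v, the characteristic functions also converge to the Gaussian one of variance v,
  -- which identifies the law of the limit.
  have hmap : μ.map Y = gaussianReal 0 v.toNNReal := by
    refine Measure.ext_of_charFun (funext fun t => tendsto_nhds_unique (hconv t) ?_)
    rw [charFun_gaussianReal, Real.coe_toNNReal _ hv]
    have hc : Continuous fun x : ℝ => Complex.exp (-((x * t ^ 2 / 2 : ℝ) : ℂ)) := by fun_prop
    have h2 := (hc.tendsto v).comp hwlim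
    have h3 : Complex.exp (t * (0 : ℝ) * Complex.I - v * t ^ 2 / 2) =
        Complex.exp (-((v * t ^ 2 / 2 : ℝ) : ℂ)) := by
      congr 1
      push_cast
      ring
    rw [h3]
    refine h2.congr fun m => ?_
    rw [(hZ m).charFun_eq]
    rfl
  have hG : IsCenteredGaussian Y μ := of_map_eq hYm hmap
  refine ⟨hG, ?_⟩
  have hvar : ∫ ω, Y ω ^ 2 ∂μ = v := by
    have h4 := hG.map_eq
    rw [hmap] at h4
    have h5 := congrArg (fun ν => Var[id; ν]) h4
    simp only [variance_id_gaussianReal] at h5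
    rwa [Real.coe_toNNReal _ hv, Real.coe_toNNReal _ (integral_nonneg fun ω => sq_nonneg _),
      eq_comm] at h5
  rw [hvar]
  exact hwlim

end IsCenteredGaussian

/-- A linear space of centered Gaussian random variables. -/
def IsGaussianSpace (M : Submodule ℝ (Ω → ℝ)) (μ : Measure Ω) : Prop :=
  ∀ Y ∈ M, IsCenteredGaussian Y μ

/-- The almost sure limits of sequences of a linear space of random variables. -/
def aeClosure (M : Submodule ℝ (Ω → ℝ)) (μ : Measure Ω) : Submodule ℝ (Ω → ℝ) where
  carrier := {Y | ∃ Z : ℕ → Ω → ℝ, (∀ m, Z m ∈ M) ∧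
    ∀ᵐ ω ∂μ, Tendsto (fun m => Z m ω) atTop (𝓝 (Y ω))}
  zero_mem' := ⟨0, fun _ => M.zero_mem, by simp⟩
  add_mem' := by
    rintro Y Y' ⟨Z, hZ, h⟩ ⟨Z', hZ', h'⟩
    refine ⟨Z + Z', fun m => M.add_mem (hZ m) (hZ' m), ?_⟩
    filter_upwards [h, h'] with ω a b using a.add b
  smul_mem' := by
    rintro c Y ⟨Z, hZ, h⟩
    refine ⟨c • Z, fun m => M.smul_mem c (hZ m), ?_⟩
    filter_upwards [h] with ω a using a.const_mul c

lemma le_aeClosure (M : Submodule ℝ (Ω → ℝ)) (μ : Measure Ω) : M ≤ aeClosure M μ :=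
  fun Y hY => ⟨fun _ => Y, fun _ => hY, by simp⟩

lemma IsGaussianSpace.aeClosure [IsProbabilityMeasure μ] {M : Submodule ℝ (Ω → ℝ)}
    (hM : IsGaussianSpace M μ) : IsGaussianSpace (aeClosure M μ) μ := by
  rintro Y ⟨Z, hZ, h⟩
  exact (IsCenteredGaussian.of_tendsto (fun m => hM _ (hZ m)) h).1

lemma isGaussianSpace_span {T : Type*} {G : T → Ω → ℝ} (hG : IsGaussianProcess G μ)
    (h0 : ∀ t, ∫ ω, G t ω ∂μ = 0) : IsGaussianSpace (Submodule.span ℝ (Set.range G)) μ := by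
  intro Y hY
  obtain ⟨c, rfl⟩ := Finsupp.mem_span_range_iff_exists_finsupp.1 hY
  have he : (c.sum fun t a => a • G t) = fun ω => ∑ t ∈ c.support, c t • G t ω := by
    ext ω
    simp [Finsupp.sum]
  rw [he]
  refine ⟨(hG.smul c).hasGaussianLaw_fun_sum, ?_⟩
  rw [integral_finsetSum]
  · simp [integral_const_mul, h0]
  · intro t _
    exact ((hG.hasGaussianLaw_eval t).integrable).smul (c t)

variable {M : Submodule ℝ (Ω → ℝ)} {Y W : Ω → ℝ}

lemma IsGaussianSpace.integrable_mul (hM : IsGaussianSpace M μ) (hY : Y ∈ M) (hW : W ∈ M) :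
    Integrable (fun ω => Y ω * W ω) μ :=
  ((hM _ hY).memLp (p := 2) (by simp)).integrable_mul ((hM _ hW).memLp (p := 2) (by simp))

lemma IsGaussianSpace.integral_add_sq (hM : IsGaussianSpace M μ) (hY : Y ∈ M) (hW : W ∈ M) :
    ∫ ω, (Y + W) ω ^ 2 ∂μ =
      ∫ ω, Y ω ^ 2 ∂μ + 2 * ∫ ω, Y ω * W ω ∂μ + ∫ ω, W ω ^ 2 ∂μ := by
  have h1 := (hM _ hY).integrable_pow 2
  have h2 := (hM.integrable_mul hY hW).const_mul 2
  have h3 := (hM _ hW).integrable_pow 2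
  rw [← integral_const_mul, ← integral_add h1 h2, ← integral_add (h1.fun_add h2) h3]
  refine integral_congr_ae (Eventually.of_forall fun ω => ?_)
  simp only [Pi.add_apply]
  ring

lemma IsGaussianSpace.integral_sub_sq (hM : IsGaussianSpace M μ) (hY : Y ∈ M) (hW : W ∈ M) :
    ∫ ω, (Y - W) ω ^ 2 ∂μ =
      ∫ ω, Y ω ^ 2 ∂μ - 2 * ∫ ω, Y ω * W ω ∂μ + ∫ ω, W ω ^ 2 ∂μ := by
  have h := hM.integral_add_sq hY (M.neg_mem hW)
  rw [← sub_eq_add_neg] at h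
  rw [h]
  simp only [Pi.neg_apply, mul_neg, integral_neg, even_two, Even.neg_pow]
  ring

/-- Isserlis' formula for squares. -/
lemma IsGaussianSpace.integral_sq_mul_sq (hM : IsGaussianSpace M μ) (hY : Y ∈ M) (hW : W ∈ M) :
    Integrable (fun ω => Y ω ^ 2 * W ω ^ 2) μ ∧
    ∫ ω, Y ω ^ 2 * W ω ^ 2 ∂μ =
      (∫ ω, Y ω ^ 2 ∂μ) * (∫ ω, W ω ^ 2 ∂μ) + 2 * (∫ ω, Y ω * W ω ∂μ) ^ 2 := by
  have ha := hM _ (M.add_mem hY hW)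
  have hs := hM _ (M.sub_mem hY hW)
  have i1 := ha.integrable_pow 4
  have i2 := hs.integrable_pow 4
  have i3 := ((hM _ hY).integrable_pow 4).const_mul 2
  have i4 := ((hM _ hW).integrable_pow 4).const_mul 2
  -- Polarization: 12 Y²W² is a combination of fourth powers of elements of the space, each known
  -- from its variance.
  have he : (fun ω => Y ω ^ 2 * W ω ^ 2) = fun ω =>
      (1 / 12) * ((Y + W) ω ^ 4 + (Y - W) ω ^ 4 - 2 * Y ω ^ 4 - 2 * W ω ^ 4) := by
    ext ω
    simp only [Pi.add_apply, Pi.sub_apply]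
    ring
  rw [he]
  refine ⟨(((i1.add i2).sub i3).sub i4).const_mul _, ?_⟩
  rw [integral_const_mul, integral_sub (by exact (i1.add i2).sub i3) i4,
    integral_sub (i1.fun_add i2) i3,
    integral_add i1 i2, ha.integral_pow_four, hs.integral_pow_four, integral_const_mul,
    integral_const_mul, (hM _ hY).integral_pow_four, (hM _ hW).integral_pow_four,
    hM.integral_add_sq hY hW, hM.integral_sub_sq hY hW]
  ring

/-- Variances converge along almost sure limits of centered Gaussian variables; polarization with
sums and differences carries this to covariances, without any domination hypothesis. -/
lemma IsGaussianSpace.tendsto_integral_mul [IsProbabilityMeasure μ] (hM : IsGaussianSpace M μ)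
    {A B : ℕ → Ω → ℝ} (hA : ∀ m, A m ∈ M) (hB : ∀ m, B m ∈ M)
    (hAY : ∀ᵐ ω ∂μ, Tendsto (fun m => A m ω) atTop (𝓝 (Y ω)))
    (hBW : ∀ᵐ ω ∂μ, Tendsto (fun m => B m ω) atTop (𝓝 (W ω))) :
    Tendsto (fun m => ∫ ω, A m ω * B m ω ∂μ) atTop (𝓝 (∫ ω, Y ω * W ω ∂μ)) := by
  have hC := hM.aeClosure
  have hY : Y ∈ SubFracOU.aeClosure M μ := ⟨A, hA, hAY⟩
  have hW : W ∈ SubFracOU.aeClosure M μ := ⟨B, hB, hBW⟩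
  have h1 := (IsCenteredGaussian.of_tendsto (Y := Y + W) (Z := A + B)
    (fun m => hM _ (M.add_mem (hA m) (hB m))) (by
      filter_upwards [hAY, hBW] with ω a b using a.add b)).2
  have h2 := (IsCenteredGaussian.of_tendsto (Y := Y - W) (Z := A - B)
    (fun m => hM _ (M.sub_mem (hA m) (hB m))) (by
      filter_upwards [hAY, hBW] with ω a b using a.sub b)).2
  have h3 := (h1.sub h2).const_mul (1 / 4)
  rw [hC.integral_add_sq hY hW, hC.integral_sub_sq hY hW] at h3
  convert h3 using 2 with m
  · rw [Pi.add_apply, Pi.sub_apply, hM.integral_add_sq (hA m) (hB m),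
      hM.integral_sub_sq (hA m) (hB m)]
    ring
  · ring

end GaussianSpaces

/-! ### The Ornstein-Uhlenbeck functional and its Riemann-Stieltjes sums -/

section Functional

/-- The functional `f ↦ ∫_T^t e^{-θ(t-u)} df(u)`, integrated by parts. -/
noncomputable def ouFunctional (θ T t : ℝ) (f : ℝ → ℝ) : ℝ :=
  f t - Real.exp (-θ * (t - T)) * f T - θ * ∫ u in T..t, Real.exp (-θ * (t - u)) * f u

/-- Only values on [T, t] matter, so a kernel given for nonnegative times may be replaced by any
convenient extension to the whole line. -/
lemma ouFunctional_congr {θ T t : ℝ} (h : T ≤ t) {f g : ℝ → ℝ}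
    (hfg : ∀ u ∈ Set.Icc T t, f u = g u) : ouFunctional θ T t f = ouFunctional θ T t g := by
  have : ∫ u in T..t, Real.exp (-θ * (t - u)) * f u =
      ∫ u in T..t, Real.exp (-θ * (t - u)) * g u := by
    refine intervalIntegral.integral_congr fun u hu => ?_
    rw [Set.uIcc_of_le h] at hu
    simp only [hfg u hu]
  rw [ouFunctional, ouFunctional, this, hfg t (by simp [h]), hfg T (by simp [h])]

lemma ouFunctional_const_mul (θ T t c : ℝ) (f : ℝ → ℝ) :
    ouFunctional θ T t (fun u => c * f u) = c * ouFunctional θ T t f := by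
  have : ∫ u in T..t, Real.exp (-θ * (t - u)) * (c * f u) =
      c * ∫ u in T..t, Real.exp (-θ * (t - u)) * f u := by
    rw [← intervalIntegral.integral_const_mul]
    congr with u
    ring
  rw [ouFunctional, ouFunctional, this]
  ring

lemma ouFunctional_add (θ T t : ℝ) {f g : ℝ → ℝ} (hf : Continuous f) (hg : Continuous g) :
    ouFunctional θ T t (fun u => f u + g u) = ouFunctional θ T t f + ouFunctional θ T t g := by
  have : ∫ u in T..t, Real.exp (-θ * (t - u)) * (f u + g u) =
      (∫ u in T..t, Real.exp (-θ * (t - u)) * f u) +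
        ∫ u in T..t, Real.exp (-θ * (t - u)) * g u := by
    rw [← intervalIntegral.integral_add]
    · congr with u
      ring
    · exact Continuous.intervalIntegrable (by fun_prop) _ _
    · exact Continuous.intervalIntegrable (by fun_prop) _ _
  rw [ouFunctional, ouFunctional, ouFunctional, this]
  ring

lemma hasDerivAt_exp_kernel (θ t u : ℝ) :
    HasDerivAt (fun u => Real.exp (-θ * (t - u))) (θ * Real.exp (-θ * (t - u))) u := by
  have := ((hasDerivAt_id u).const_sub t).const_mul (-θ)
  refine this.exp.congr_deriv ?_
  simp
  ring

lemma integral_exp_kernel (θ t a b : ℝ) :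
    ∫ u in a..b, θ * Real.exp (-θ * (t - u)) =
      Real.exp (-θ * (t - b)) - Real.exp (-θ * (t - a)) :=
  intervalIntegral.integral_eq_sub_of_hasDerivAt (fun u _ => hasDerivAt_exp_kernel θ t u)
    (Continuous.intervalIntegrable (by fun_prop) _ _)

/-- An integral against dc vanishes. This is what removes from a covariance kernel the terms
depending on one variable only. -/
lemma ouFunctional_const (θ T t c : ℝ) : ouFunctional θ T t (fun _ => c) = 0 := by
  have : θ * ∫ u in T..t, Real.exp (-θ * (t - u)) * c =
      (1 - Real.exp (-θ * (t - T))) * c := by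
    rw [intervalIntegral.integral_mul_const, ← mul_assoc, ← intervalIntegral.integral_const_mul,
      integral_exp_kernel]
    simp
  rw [ouFunctional, this]
  ring

/-- The regular subdivision of `[T, t]` in `m + 1` intervals. -/
noncomputable def gridPoint (T t : ℝ) (m i : ℕ) : ℝ := T + (t - T) * (i / (m + 1))

lemma gridPoint_zero (T t : ℝ) (m : ℕ) : gridPoint T t m 0 = T := by simp [gridPoint]

lemma gridPoint_last (T t : ℝ) (m : ℕ) : gridPoint T t m (m + 1) = t := by
  have : (m : ℝ) + 1 ≠ 0 := by positivity
  simp [gridPoint, div_self this]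

lemma gridPoint_succ_sub (T t : ℝ) (m i : ℕ) :
    gridPoint T t m (i + 1) - gridPoint T t m i = (t - T) / (m + 1) := by
  simp only [gridPoint]
  push_cast
  ring

lemma gridPoint_mono {T t : ℝ} (h : T ≤ t) (m : ℕ) : Monotone (gridPoint T t m) := by
  refine monotone_nat_of_le_succ fun i => ?_
  have h1 := gridPoint_succ_sub T t m i
  have h2 : 0 ≤ (t - T) / ((m : ℝ) + 1) := div_nonneg (by linarith) (by positivity)
  linarith

lemma gridPoint_mem {T t : ℝ} (h : T ≤ t) {m i : ℕ} (hi : i ≤ m + 1) :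
    gridPoint T t m i ∈ Set.Icc T t := by
  have h1 := gridPoint_mono h m (Nat.zero_le i)
  have h2 := gridPoint_mono h m hi
  rw [gridPoint_zero] at h1
  rw [gridPoint_last] at h2
  exact ⟨h1, h2⟩

lemma sum_mul_sub_by_parts (a b : ℕ → ℝ) (n : ℕ) :
    ∑ i ∈ Finset.range n, a i * (b (i + 1) - b i) =
      a n * b n - a 0 * b 0 - ∑ i ∈ Finset.range n, b (i + 1) * (a (i + 1) - a i) := by
  have h := Finset.sum_range_sub (fun i => a i * b i) n
  rw [← h, eq_sub_iff_add_eq, ← Finset.sum_add_distrib]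
  exact Finset.sum_congr rfl fun i _ => by ring

/-- The Riemann-Stieltjes sums of `∫_T^t e^{-θ(t-u)} df(u)` converge to the functional. -/
lemma tendsto_sum_ouFunctional {θ T t : ℝ} (hθ : 0 < θ) (h : T ≤ t) {f : ℝ → ℝ}
    (hf : Continuous f) :
    Tendsto (fun m : ℕ => ∑ i ∈ Finset.range (m + 1), Real.exp (-θ * (t - gridPoint T t m i)) *
      (f (gridPoint T t m (i + 1)) - f (gridPoint T t m i))) atTop (𝓝 (ouFunctional θ T t f)) := by
  have huc := isCompact_Icc.uniformContinuousOn_of_continuous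
    (hf.continuousOn (s := Set.Icc T t))
  rw [Metric.uniformContinuousOn_iff_le] at huc
  rw [Metric.tendsto_atTop]
  intro ε hε
  -- The total error will be at most ε θ(t-T) / (2(θ(t-T)+1)); the added 1 keeps the divisor
  -- positive when t = T.
  have hD : 0 < θ * (t - T) + 1 := by nlinarith
  obtain ⟨δ, hδ, hfδ⟩ := huc (ε / (2 * (θ * (t - T) + 1))) (by positivity)
  obtain ⟨N, hN⟩ := exists_nat_gt ((t - T) / δ)
  refine ⟨N, fun m hm => ?_⟩
  set p := gridPoint T t m with hp
  have hmesh (i : ℕ) : p (i + 1) - p i ≤ δ := by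
    rw [hp, gridPoint_succ_sub, div_le_iff₀ (by positivity)]
    rw [div_lt_iff₀ hδ] at hN
    have : (N : ℝ) ≤ m := by exact_mod_cast hm
    nlinarith
  have hint (a b : ℝ) : IntervalIntegrable
      (fun u => θ * (Real.exp (-θ * (t - u)) * f u)) volume a b :=
    Continuous.intervalIntegrable (by fun_prop) _ _
  have hsum : θ * ∫ u in T..t, Real.exp (-θ * (t - u)) * f u =
      ∑ i ∈ Finset.range (m + 1), ∫ u in p i..p (i + 1),
        θ * (Real.exp (-θ * (t - u)) * f u) := by
    rw [intervalIntegral.sum_integral_adjacent_intervals fun i _ => hint _ _, hp, gridPoint_zero,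
      gridPoint_last, intervalIntegral.integral_const_mul]
  have hterm : ∀ i ∈ Finset.range (m + 1),
      |f (p (i + 1)) * (Real.exp (-θ * (t - p (i + 1))) - Real.exp (-θ * (t - p i))) -
        ∫ u in p i..p (i + 1), θ * (Real.exp (-θ * (t - u)) * f u)| ≤
        ε / (2 * (θ * (t - T) + 1)) * (θ * (p (i + 1) - p i)) := by
    intro i hi
    have hi' := Finset.mem_range.1 hi
    have hle : p i ≤ p (i + 1) := gridPoint_mono h m (Nat.le_succ i)
    have m1 := gridPoint_mem h (show i ≤ m + 1 by omega)
    have m2 := gridPoint_mem h (show i + 1 ≤ m + 1 by omega)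
    rw [← integral_exp_kernel, ← intervalIntegral.integral_const_mul,
      ← intervalIntegral.integral_sub (Continuous.intervalIntegrable (by fun_prop) _ _) (hint _ _),
      ← Real.norm_eq_abs]
    refine (intervalIntegral.norm_integral_le_of_norm_le_const
      (C := ε / (2 * (θ * (t - T) + 1)) * θ) fun u hu => ?_).trans ?_
    · rw [Set.uIoc_of_le hle] at hu
      have hu' : u ∈ Set.Icc T t := ⟨m1.1.trans hu.1.le, hu.2.trans m2.2⟩
      have h1 := hfδ _ m2 _ hu' (by
        rw [Real.dist_eq, abs_of_nonneg (by linarith [hu.2])]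
        linarith [hmesh i, hu.1])
      rw [Real.dist_eq] at h1
      have h2 : Real.exp (-θ * (t - u)) ≤ 1 := Real.exp_le_one_iff.2 (by nlinarith [hu'.2])
      rw [show f (p (i + 1)) * (θ * Real.exp (-θ * (t - u))) -
          θ * (Real.exp (-θ * (t - u)) * f u) =
          (f (p (i + 1)) - f u) * (θ * Real.exp (-θ * (t - u))) by ring, norm_mul,
        Real.norm_eq_abs, Real.norm_eq_abs, abs_of_pos (show 0 < θ * Real.exp (-θ * (t - u)) by
          positivity)]
      exact mul_le_mul h1 (by nlinarith) (by positivity) (by positivity)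
    · rw [abs_of_nonneg (by linarith), mul_assoc]
  -- Summation by parts moves the increments from f, which is only continuous, to the smooth
  -- exponential. What remains is a Riemann sum with values of f at right endpoints, compared cell
  -- by cell with the integral.
  rw [Real.dist_eq, sum_mul_sub_by_parts (fun i => Real.exp (-θ * (t - p i))) (fun i => f (p i)),
    ouFunctional, hsum]
  have e1 : p (m + 1) = t := gridPoint_last T t m
  have e0 : p 0 = T := gridPoint_zero T t m
  simp only [e1, e0, sub_self, mul_zero, Real.exp_zero, one_mul]
  rw [show ∀ a b c d : ℝ, a - b - c - (a - b - d) = -(c - d) by intros; ring, abs_neg,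
    ← Finset.sum_sub_distrib]
  refine (Finset.abs_sum_le_sum_abs _ _).trans_lt ((Finset.sum_le_sum hterm).trans_lt ?_)
  rw [← Finset.mul_sum, ← Finset.mul_sum, Finset.sum_range_sub, e1, e0, div_mul_eq_mul_div,
    div_lt_iff₀ (by positivity)]
  nlinarith

/-- Along the regular subdivisions, tagged at left endpoints, the Stieltjes sums have both limits,
so these agree. -/
lemma ouFunctional_eq_of_isStieltjesIntegral {θ T t I : ℝ} (hθ : 0 < θ) (h : T ≤ t) {f : ℝ → ℝ}
    (hf : Continuous f)
    (hI : IsStieltjesIntegral (fun u => Real.exp (θ * u)) f T t I) :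
    Real.exp (-θ * t) * I = ouFunctional θ T t f := by
  refine tendsto_nhds_unique ?_ (tendsto_sum_ouFunctional hθ h hf)
  have hS : Tendsto (fun m : ℕ => ∑ i ∈ Finset.range (m + 1),
      Real.exp (θ * gridPoint T t m i) *
        (f (gridPoint T t m (i + 1)) - f (gridPoint T t m i))) atTop (𝓝 I) := by
    rw [Metric.tendsto_atTop]
    intro ε hε
    obtain ⟨δ, hδ, hb⟩ := hI ε hε
    obtain ⟨N, hN⟩ := exists_nat_gt ((t - T) / δ)
    refine ⟨N, fun m hm => ?_⟩
    refine hb (m + 1) (gridPoint T t m) (gridPoint T t m) (gridPoint_zero _ _ _)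
      (gridPoint_last _ _ _) fun i _ => ⟨le_rfl, gridPoint_mono h m (Nat.le_succ i), ?_⟩
    rw [gridPoint_succ_sub, div_lt_iff₀ (by positivity)]
    rw [div_lt_iff₀ hδ] at hN
    have : (N : ℝ) ≤ m := by exact_mod_cast hm
    nlinarith
  refine (hS.const_mul _).congr fun m => ?_
  rw [Finset.mul_sum]
  refine Finset.sum_congr rfl fun i _ => ?_
  rw [← mul_assoc, ← Real.exp_add]
  congr 2
  ring

/-- The solution of `x = g - θ ∫ x`, `g(0) = 0`, is given by the functional. -/
lemma eq_ouFunctional_of_integral_equation {θ : ℝ} {x g : ℝ → ℝ} (hx : Continuous x)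
    (hg0 : g 0 = 0)
    (heq : ∀ t, 0 ≤ t → x t = g t - θ * ∫ s in (0 : ℝ)..t, x s) {t : ℝ} (ht : 0 ≤ t) :
    x t = ouFunctional θ 0 t g := by
  have hJ (s : ℝ) : HasDerivAt (fun s => ∫ r in (0 : ℝ)..s, x r) (x s) s :=
    intervalIntegral.integral_hasDerivAt_right (hx.intervalIntegrable _ _)
      hx.stronglyMeasurable.stronglyMeasurableAtFilter hx.continuousAt
  -- With J(s) = ∫_0^s x, the equation reads x + θJ = g, so e^{-θ(t-s)} J(s) has derivative
  -- e^{-θ(t-s)} g(s). Integrating over [0, t] expresses J(t) through g alone.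
  have hE (s : ℝ) : HasDerivAt
      (fun s => Real.exp (-θ * (t - s)) * ∫ r in (0 : ℝ)..s, x r)
      (θ * Real.exp (-θ * (t - s)) * (∫ r in (0 : ℝ)..s, x r) + Real.exp (-θ * (t - s)) * x s) s :=
    (hasDerivAt_exp_kernel θ t s).mul (hJ s)
  have hcJ : Continuous fun s => ∫ r in (0 : ℝ)..s, x r :=
    continuous_iff_continuousAt.2 fun s => (hJ s).continuousAt
  have h1 := intervalIntegral.integral_eq_sub_of_hasDerivAt (a := 0) (b := t)
    (fun s _ => hE s) (Continuous.intervalIntegrable (by fun_prop) _ _)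
  simp only [sub_self, mul_zero, Real.exp_zero, one_mul, intervalIntegral.integral_same,
    sub_zero] at h1
  have h2 : ∫ s in (0 : ℝ)..t, (θ * Real.exp (-θ * (t - s)) * (∫ r in (0 : ℝ)..s, x r) +
      Real.exp (-θ * (t - s)) * x s) = ∫ s in (0 : ℝ)..t, Real.exp (-θ * (t - s)) * g s := by
    refine intervalIntegral.integral_congr fun s hs => ?_
    rw [Set.uIcc_of_le ht] at hs
    rw [heq s hs.1]
    ring
  rw [heq t ht, ← h1, h2, ouFunctional, hg0]
  ring

end Functional

/-! ### The two Ornstein-Uhlenbeck processes as Gaussian functionals of their drivers -/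

section Processes

/-- The Riemann-Stieltjes sums of `∫_T^t e^{-θ(t-u)} dG_u`. -/
noncomputable def ouSum {Ω : Type*} (θ T t : ℝ) (G : ℝ → Ω → ℝ) (m : ℕ) : Ω → ℝ :=
  ∑ i ∈ Finset.range (m + 1), Real.exp (-θ * (t - gridPoint T t m i)) •
      (G (gridPoint T t m (i + 1)) - G (gridPoint T t m i))

lemma ouSum_mem {Ω : Type*} {M : Submodule ℝ (Ω → ℝ)} {G : ℝ → Ω → ℝ}
    (hG : ∀ u, G u ∈ M) (θ T t : ℝ) (m : ℕ) : ouSum θ T t G m ∈ M :=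
  M.sum_mem fun _ _ => M.smul_mem _ (M.sub_mem (hG _) (hG _))

variable {Ω : Type*} [MeasurableSpace Ω] {μ : Measure Ω} {M : Submodule ℝ (Ω → ℝ)}

lemma mem_aeClosure_of_ae_eq {Y Y' : Ω → ℝ} (hY : Y ∈ aeClosure M μ) (h : Y =ᵐ[μ] Y') :
    Y' ∈ aeClosure M μ := by
  obtain ⟨Z, hZ, hlim⟩ := hY
  refine ⟨Z, hZ, ?_⟩
  filter_upwards [hlim, h] with ω a b
  rwa [← b]

variable {G : ℝ → Ω → ℝ} {θ : ℝ}

lemma ae_tendsto_ouSum (hθ : 0 < θ) (hc : ∀ᵐ ω ∂μ, Continuous fun u => G u ω) {T t : ℝ}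
    (h : T ≤ t) : ∀ᵐ ω ∂μ, Tendsto (fun m => ouSum θ T t G m ω) atTop
      (𝓝 (ouFunctional θ T t fun u => G u ω)) := by
  filter_upwards [hc] with ω hω
  simpa [ouSum] using tendsto_sum_ouFunctional hθ h hω

lemma ouFunctional_mem (hθ : 0 < θ) (hG : ∀ u, G u ∈ M)
    (hc : ∀ᵐ ω ∂μ, Continuous fun u => G u ω) {T t : ℝ} (h : T ≤ t) :
    (fun ω => ouFunctional θ T t fun u => G u ω) ∈ aeClosure M μ :=
  ⟨ouSum θ T t G, ouSum_mem hG θ T t, ae_tendsto_ouSum hθ hc h⟩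

/-- Path continuity gives almost sure convergence along sequences, which in a Gaussian space already
implies convergence of covariances. -/
lemma continuous_integral_mul [IsProbabilityMeasure μ] (hM : IsGaussianSpace M μ)
    (hG : ∀ u, G u ∈ M) (hc : ∀ᵐ ω ∂μ, Continuous fun u => G u ω) {W : Ω → ℝ} (hW : W ∈ M) :
    Continuous fun u => ∫ ω, G u ω * W ω ∂μ := by
  refine continuous_iff_seqContinuous.2 fun x a hx => ?_
  refine hM.tendsto_integral_mul (B := fun _ => W) (fun m => hG (x m)) (fun _ => hW) ?_
    (by simp)
  filter_upwards [hc] with ω hω using (hω.tendsto a).comp hx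

/-- The expectation commutes with the finite Riemann-Stieltjes sums; both sides are limits of these,
so no Fubini argument on the paths is required. -/
lemma integral_ouFunctional_mul [IsProbabilityMeasure μ] (hM : IsGaussianSpace M μ) (hθ : 0 < θ)
    (hG : ∀ u, G u ∈ M) (hc : ∀ᵐ ω ∂μ, Continuous fun u => G u ω) {T t : ℝ}
    (h : T ≤ t) {W : Ω → ℝ} (hW : W ∈ M) :
    ∫ ω, (ouFunctional θ T t fun u => G u ω) * W ω ∂μ =
      ouFunctional θ T t fun u => ∫ ω, G u ω * W ω ∂μ := by
  have h1 := hM.tendsto_integral_mul (B := fun _ => W) (W := W) (ouSum_mem hG θ T t) (fun _ => hW)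
    (ae_tendsto_ouSum hθ hc h) (by simp)
  refine tendsto_nhds_unique h1 ?_
  refine (tendsto_sum_ouFunctional hθ h (continuous_integral_mul hM hG hc hW)).congr fun m => ?_
  have hi (u : ℝ) := hM.integrable_mul (hG u) hW
  simp only [ouSum, Finset.sum_apply, Pi.smul_apply, Pi.sub_apply, smul_eq_mul, Finset.sum_mul]
  rw [integral_finsetSum]
  · refine Finset.sum_congr rfl fun i _ => ?_
    rw [← integral_sub (hi _) (hi _), ← integral_const_mul]
    congr with ω
    ring
  · intro i _
    refine (((hi (gridPoint T t m (i + 1))).sub (hi (gridPoint T t m i))).const_mul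
      (Real.exp (-θ * (t - gridPoint T t m i)))).congr (Eventually.of_forall fun ω => ?_)
    simp only [Pi.sub_apply]
    ring

lemma integral_ouFunctional_mul_ouFunctional [IsProbabilityMeasure μ] (hM : IsGaussianSpace M μ)
    (hθ : 0 < θ) (hG : ∀ u, G u ∈ M) (hc : ∀ᵐ ω ∂μ, Continuous fun u => G u ω) {T s t : ℝ}
    (hs : T ≤ s) (ht : T ≤ t) :
    ∫ ω, (ouFunctional θ T s fun u => G u ω) * (ouFunctional θ T t fun u => G u ω) ∂μ =
      ouFunctional θ T t fun v => ouFunctional θ T s fun u => ∫ ω, G u ω * G v ω ∂μ := by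
  have hG' (u : ℝ) := le_aeClosure M μ (hG u)
  simp_rw [mul_comm (ouFunctional θ T s fun u => G u _)]
  -- The factor at time s is only a limit of elements of `M`, so the first exchange takes place in
  -- the closure.
  rw [integral_ouFunctional_mul hM.aeClosure hθ hG' hc ht (ouFunctional_mem hθ hG hc hs)]
  congr with v
  simp_rw [mul_comm (G v _)]
  exact integral_ouFunctional_mul hM.aeClosure hθ hG' hc hs (hG' v)

/-- The solution driven by a sub-fractional Brownian motion lies in a Gaussian space, and its
covariance is the image of the one of the driving process. -/
lemma IsOUSolution.gaussian [IsProbabilityMeasure μ] {S X : ℝ≥0 → Ω → ℝ} {H : ℝ} (hθ : 0 < θ)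
    (hS : IsSubFracBM H S μ) (hX : IsOUSolution θ S X μ) :
    (∃ M : Submodule ℝ (Ω → ℝ), IsGaussianSpace M μ ∧ ∀ t, X t ∈ M) ∧
    ∀ s t : ℝ≥0, ∫ ω, X s ω * X t ω ∂μ =
      ouFunctional θ 0 t fun v => ouFunctional θ 0 s fun u =>
        subFracCov H (u.toNNReal : ℝ) (v.toNNReal : ℝ) := by
  have hM := isGaussianSpace_span hS.gaussian hS.mean_zero
  have hG (u : ℝ) : S u.toNNReal ∈ Submodule.span ℝ (Set.range S) :=
    Submodule.subset_span ⟨_, rfl⟩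
  have hc : ∀ᵐ ω ∂μ, Continuous fun u : ℝ => S u.toNNReal ω := by
    filter_upwards [hS.continuous_paths] with ω hω using hω.comp continuous_real_toNNReal
  have hXS (t : ℝ≥0) : (fun ω => ouFunctional θ 0 t fun u : ℝ => S u.toNNReal ω) =ᵐ[μ] X t := by
    filter_upwards [hS.continuous_paths, hX.continuous_paths, hX.initial, hX.equation]
      with ω hSω hXω h0 heq
    -- The equation at t = 0 together with X_0 = 0 forces the driver to start at 0.
    have hS0 : S 0 ω = 0 := by
      have h1 := heq 0
      simpa [h0, eq_comm] using h1
    have h2 := eq_ouFunctional_of_integral_equation (θ := θ) (x := fun u => X u.toNNReal ω)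
      (g := fun u => S u.toNNReal ω) (hXω.comp continuous_real_toNNReal)
      (by simpa using hS0) (fun r hr => by
        have h3 := heq r.toNNReal
        rwa [Real.coe_toNNReal r hr] at h3) t.coe_nonneg
    simp only [Real.toNNReal_coe] at h2
    exact h2.symm
  refine ⟨⟨_, hM.aeClosure, fun t =>
    mem_aeClosure_of_ae_eq (ouFunctional_mem hθ hG hc t.2) (hXS t)⟩, fun s t => ?_⟩
  have h4 := integral_ouFunctional_mul_ouFunctional hM hθ hG hc s.2 t.2
  simp_rw [hS.covariance] at h4
  refine Eq.trans (integral_congr_ae ?_) h4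
  filter_upwards [hXS s, hXS t] with ω a b
  rw [← a, ← b]
  rfl

/-- The stationary Ornstein-Uhlenbeck process lies in a Gaussian space, and its covariance is the
limit of the images of the one of the driving process. -/
lemma IsStationaryOU.gaussian [IsProbabilityMeasure μ] {B Z : ℝ → Ω → ℝ} {H : ℝ} (hθ : 0 < θ)
    (hB : IsFracBM H B μ) (hZ : IsStationaryOU θ B Z μ) :
    (∃ M : Submodule ℝ (Ω → ℝ), IsGaussianSpace M μ ∧ ∀ t, Z t ∈ M) ∧
    ∀ (s t : ℝ) (T₀ : ℕ), -(T₀ : ℝ) ≤ s → -(T₀ : ℝ) ≤ t →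
      Tendsto (fun m : ℕ => ouFunctional θ (-((m + T₀ : ℕ) : ℝ)) t fun v =>
        ouFunctional θ (-((m + T₀ : ℕ) : ℝ)) s fun u => fracCov H u v) atTop
        (𝓝 (∫ ω, Z s ω * Z t ω ∂μ)) := by
  have hM := isGaussianSpace_span hB.gaussian hB.mean_zero
  have hG (u : ℝ) : B u ∈ Submodule.span ℝ (Set.range B) := Submodule.subset_span ⟨_, rfl⟩
  have hc := hB.continuous_paths
  have hlim (t : ℝ) (T₀ : ℕ) (hT : -(T₀ : ℝ) ≤ t) : ∀ᵐ ω ∂μ, Tendsto (fun m : ℕ =>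
      ouFunctional θ (-((m + T₀ : ℕ) : ℝ)) t fun u => B u ω) atTop (𝓝 (Z t ω)) := by
    filter_upwards [hc, hZ t] with ω hω hI
    obtain ⟨I, hI, hlim⟩ := hI
    have hbot : Tendsto (fun m : ℕ => -((m + T₀ : ℕ) : ℝ)) atTop atBot :=
      tendsto_neg_atTop_atBot.comp
        (tendsto_natCast_atTop_atTop.comp (tendsto_add_atTop_nat T₀))
    refine (hlim.comp hbot).congr fun m => ?_
    have hle : -((m + T₀ : ℕ) : ℝ) ≤ t := by
      push_cast
      linarith [(Nat.cast_nonneg m : (0 : ℝ) ≤ m)]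
    exact ouFunctional_eq_of_isStieltjesIntegral hθ hle hω (hI _ hle)
  -- Two closures: one for the truncated integrals as limits of Riemann sums, one for the limit T →
  -- -∞ along negative integers.
  refine ⟨⟨_, hM.aeClosure.aeClosure, fun t => ?_⟩, fun s t T₀ hs ht => ?_⟩
  · obtain ⟨T₀, hT₀⟩ := exists_nat_ge (-t)
    refine ⟨_, fun m => ouFunctional_mem hθ hG hc ?_, hlim t T₀ (by linarith)⟩
    push_cast
    linarith [(Nat.cast_nonneg m : (0 : ℝ) ≤ m)]
  · have hle (r : ℝ) (hr : -(T₀ : ℝ) ≤ r) (m : ℕ) : -((m + T₀ : ℕ) : ℝ) ≤ r := by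
      push_cast
      linarith [(Nat.cast_nonneg m : (0 : ℝ) ≤ m)]
    have h1 := hM.aeClosure.tendsto_integral_mul
      (fun m => ouFunctional_mem hθ hG hc (hle s hs m))
      (fun m => ouFunctional_mem hθ hG hc (hle t ht m)) (hlim s T₀ hs) (hlim t T₀ ht)
    refine h1.congr fun m => ?_
    rw [integral_ouFunctional_mul_ouFunctional hM hθ hG hc (hle s hs m) (hle t ht m)]
    simp_rw [hB.covariance]

end Processes

/-! ### Averages against the exponential law -/

section ExponentialLaw

variable {θ : ℝ}

lemma ae_exponentialPDF_toReal_mul (hθ : 0 < θ) (f : ℝ → ℝ) :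
    (fun x => (exponentialPDF θ x).toReal • f x) =ᵐ[volume]
      (Set.Ioi 0).indicator fun x => θ * Real.exp (-θ * x) * f x := by
  filter_upwards [compl_mem_ae_iff.2 (measure_singleton (0 : ℝ))] with x hx
  rcases lt_or_gt_of_ne (show x ≠ 0 from hx) with h | h
  · rw [exponentialPDF_of_neg h, Set.indicator_of_notMem (by simpa using h.le)]
    simp
  · rw [exponentialPDF_of_nonneg h.le, Set.indicator_of_mem (by simpa using h),
      ENNReal.toReal_ofReal (by positivity), smul_eq_mul, neg_mul]

lemma integral_expMeasure (hθ : 0 < θ) (f : ℝ → ℝ) :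
    ∫ x, f x ∂(expMeasure θ) = ∫ x in Set.Ioi 0, θ * Real.exp (-θ * x) * f x := by
  rw [← integral_indicator measurableSet_Ioi,
    ← integral_congr_ae (ae_exponentialPDF_toReal_mul hθ f)]
  exact integral_withDensity_eq_integral_toReal_smul
    (measurable_exponentialPDFReal θ).ennreal_ofReal
    (Eventually.of_forall fun x => ENNReal.ofReal_lt_top) f

lemma integrable_expMeasure_iff (hθ : 0 < θ) (f : ℝ → ℝ) :
    Integrable f (expMeasure θ) ↔
      IntegrableOn (fun x => θ * Real.exp (-θ * x) * f x) (Set.Ioi 0) := by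
  rw [← integrable_indicator_iff measurableSet_Ioi,
    ← integrable_congr (ae_exponentialPDF_toReal_mul hθ f)]
  exact integrable_withDensity_iff_integrable_smul'
    (measurable_exponentialPDFReal θ).ennreal_ofReal
    (Eventually.of_forall fun x => ENNReal.ofReal_lt_top)

lemma integrable_abs_rpow_expMeasure (hθ : 0 < θ) {a : ℝ} (ha : 0 ≤ a) :
    Integrable (fun x => |x| ^ a) (expMeasure θ) := by
  rw [integrable_expMeasure_iff hθ]
  have h := (integrableOn_rpow_mul_exp_neg_mul_rpow (p := 1) (show -1 < a by linarith) one_pos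
    hθ).const_mul θ
  refine IntegrableOn.congr_fun h (fun x hx => ?_) measurableSet_Ioi
  simp only [Real.rpow_one, abs_of_pos (Set.mem_Ioi.1 hx)]
  ring

lemma integral_abs_rpow_expMeasure (hθ : 0 < θ) {a : ℝ} (ha : 0 ≤ a) :
    ∫ x, |x| ^ a ∂(expMeasure θ) = Real.Gamma (a + 1) / θ ^ a := by
  rw [integral_expMeasure hθ]
  have h := Real.integral_rpow_mul_exp_neg_mul_Ioi (a := a + 1) (by linarith) hθ
  have h1 : ∫ x in Set.Ioi (0 : ℝ), θ * Real.exp (-θ * x) * |x| ^ a =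
      θ * ∫ x in Set.Ioi (0 : ℝ), x ^ (a + 1 - 1) * Real.exp (-(θ * x)) := by
    rw [← integral_const_mul]
    refine setIntegral_congr_fun measurableSet_Ioi fun x hx => ?_
    simp only [abs_of_pos (Set.mem_Ioi.1 hx), add_sub_cancel_right, neg_mul]
    ring
  rw [h1, h, one_div, Real.inv_rpow hθ.le, Real.rpow_add_one hθ.ne']
  field_simp

lemma integral_id_expMeasure (hθ : 0 < θ) : ∫ x, x ∂(expMeasure θ) = 1 / θ := by
  have h := integral_abs_rpow_expMeasure hθ (a := 1) zero_le_one
  rw [integral_expMeasure hθ] at h ⊢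
  rw [show (1 : ℝ) + 1 = 2 by norm_num, Real.Gamma_two, Real.rpow_one] at h
  rw [← h]
  refine setIntegral_congr_fun measurableSet_Ioi fun x hx => ?_
  simp [abs_of_pos (Set.mem_Ioi.1 hx)]

lemma setIntegral_Ioi_shift (f : ℝ → ℝ) (c : ℝ) :
    ∫ x in Set.Ioi c, f x = ∫ x in Set.Ioi 0, f (x + c) := by
  have h := (measurePreserving_add_right volume c).setIntegral_preimage_emb
    (measurableEmbedding_addRight c) f (Set.Ioi c)
  simpa using h.symm

/-- The functional on `[T, t]` in terms of exponential averages over the past of `t` and `T`. -/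
lemma ouFunctional_eq (hθ : 0 < θ) {T t : ℝ} (h : T ≤ t) {f : ℝ → ℝ}
    (hf : Integrable (fun x => f (t - x)) (expMeasure θ))
    (hf' : Integrable (fun x => f (T - x)) (expMeasure θ)) :
    ouFunctional θ T t f = ∫ x, (f t - f (t - x)) ∂(expMeasure θ) -
      Real.exp (-θ * (t - T)) * ∫ x, (f T - f (T - x)) ∂(expMeasure θ) := by
  have := isProbabilityMeasure_expMeasure hθ
  rw [integral_sub (integrable_const _) hf, integral_sub (integrable_const _) hf', integral_const,
    integral_const, integral_expMeasure hθ, integral_expMeasure hθ]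
  simp only [probReal_univ, one_smul]
  have hi := (integrable_expMeasure_iff hθ _).1 hf
  have h1 := intervalIntegral.integral_interval_add_Ioi hi
    (hi.mono_set (Set.Ioi_subset_Ioi (show (0 : ℝ) ≤ t - T by linarith)))
  have h2 : ∫ x in (0 : ℝ)..(t - T), θ * Real.exp (-θ * x) * f (t - x) =
      θ * ∫ u in T..t, Real.exp (-θ * (t - u)) * f u := by
    have h3 := intervalIntegral.integral_comp_sub_left (a := 0) (b := t - T)
      (fun u => θ * Real.exp (-θ * (t - u)) * f u) t
    simp only [sub_sub_cancel, sub_zero] at h3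
    rw [h3, ← intervalIntegral.integral_const_mul]
    congr with u
    ring
  -- Lack of memory: beyond t - T the exponential variable restarts at T, at the price of the factor
  -- e^{-θ(t-T)}.
  have h4 : ∫ x in Set.Ioi (t - T), θ * Real.exp (-θ * x) * f (t - x) =
      Real.exp (-θ * (t - T)) * ∫ x in Set.Ioi 0, θ * Real.exp (-θ * x) * f (T - x) := by
    rw [setIntegral_Ioi_shift, ← integral_const_mul]
    congr with x
    rw [show -θ * (x + (t - T)) = -θ * (t - T) + -θ * x by ring, Real.exp_add,
      show t - (x + (t - T)) = T - x by ring]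
    ring
  rw [← h1, h2, h4, ouFunctional]
  ring

end ExponentialLaw

/-! ### Images of power kernels: averaged second differences -/

section PowerKernel

variable {θ α : ℝ}

lemma abs_rpow_le (hα : 0 ≤ α) (hα2 : α ≤ 2) (u : ℝ) : |u| ^ α ≤ 1 + u ^ 2 := by
  rcases le_total |u| 1 with h | h
  · have := Real.rpow_le_one (abs_nonneg u) h hα
    nlinarith [sq_nonneg u]
  · have := Real.rpow_le_rpow_of_exponent_le h hα2
    rw [Real.rpow_two, sq_abs] at this
    linarith

/-- Products of this weight dominate the powers with exponent at most 2 and also the cubic Taylor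
remainders used later. -/
lemma integrable_weight (hθ : 0 < θ) : Integrable (fun x : ℝ => 1 + x ^ 4) (expMeasure θ) := by
  have := isProbabilityMeasure_expMeasure hθ
  refine (integrable_const 1).add ((integrable_abs_rpow_expMeasure hθ (a := 4) (by norm_num)).congr
    (Eventually.of_forall fun x => ?_))
  have : |x| ^ (4 : ℝ) = |x| ^ 4 := by exact_mod_cast Real.rpow_natCast |x| 4
  simp [this, Even.pow_abs (show Even 4 by decide)]

lemma integrable_prod_of_le (hθ : 0 < θ) {F : ℝ × ℝ → ℝ} (hF : Continuous F) (K : ℝ)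
    (hb : ∀ p : ℝ × ℝ, |F p| ≤ K * ((1 + p.1 ^ 4) * (1 + p.2 ^ 4))) :
    Integrable F ((expMeasure θ).prod (expMeasure θ)) := by
  have := isProbabilityMeasure_expMeasure hθ
  exact (((integrable_weight hθ).mul_prod (integrable_weight hθ)).const_mul K).mono'
    hF.aestronglyMeasurable (Eventually.of_forall hb)

lemma one_add_sq_add_sq_le (x y : ℝ) : 1 + x ^ 2 + y ^ 2 ≤ 2 * ((1 + x ^ 4) * (1 + y ^ 4)) := by
  nlinarith [sq_nonneg (x ^ 2 - 1), sq_nonneg (y ^ 2 - 1), mul_nonneg (pow_nonneg (sq_nonneg x) 2)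
    (pow_nonneg (sq_nonneg y) 2)]

lemma integrable_abs_rpow_prod (hθ : 0 < θ) (hα : 0 < α) (hα2 : α ≤ 2) (a b c : ℝ) :
    Integrable (fun p : ℝ × ℝ => |a + b * p.1 + c * p.2| ^ α)
      ((expMeasure θ).prod (expMeasure θ)) := by
  refine integrable_prod_of_le hθ
    (Continuous.rpow_const (by fun_prop) fun _ => Or.inr hα.le)
    (2 * (1 + 3 * (a ^ 2 + b ^ 2 + c ^ 2))) fun p => ?_
  rw [abs_of_nonneg (by positivity)]
  have h1 := abs_rpow_le hα.le hα2 (a + b * p.1 + c * p.2)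
  have h2 := one_add_sq_add_sq_le p.1 p.2
  have h3 : (a + b * p.1 + c * p.2) ^ 2 ≤ 3 * (a ^ 2 + (b * p.1) ^ 2 + (c * p.2) ^ 2) := by
    nlinarith [sq_nonneg (a - b * p.1), sq_nonneg (a - c * p.2), sq_nonneg (b * p.1 - c * p.2)]
  have h4 : 1 + (a + b * p.1 + c * p.2) ^ 2 ≤
      (1 + 3 * (a ^ 2 + b ^ 2 + c ^ 2)) * (1 + p.1 ^ 2 + p.2 ^ 2) := by
    nlinarith [mul_nonneg (sq_nonneg a) (sq_nonneg p.1), mul_nonneg (sq_nonneg a) (sq_nonneg p.2),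
      mul_nonneg (sq_nonneg b) (sq_nonneg p.2), mul_nonneg (sq_nonneg c) (sq_nonneg p.1),
      sq_nonneg b, sq_nonneg c, sq_nonneg p.1, sq_nonneg p.2]
  calc _ ≤ (1 + 3 * (a ^ 2 + b ^ 2 + c ^ 2)) * (1 + p.1 ^ 2 + p.2 ^ 2) := h1.trans h4
    _ ≤ (1 + 3 * (a ^ 2 + b ^ 2 + c ^ 2)) * (2 * ((1 + p.1 ^ 4) * (1 + p.2 ^ 4))) :=
      mul_le_mul_of_nonneg_left h2 (by positivity)
    _ = _ := by ring

/-- `w ↦ ∫ (|w|^α - |w-x|^α)` against the exponential law. -/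
noncomputable def powAvg (θ α w : ℝ) : ℝ := ∫ x, (|w| ^ α - |w - x| ^ α) ∂(expMeasure θ)

/-- Autocovariance of the stationary fractional Ornstein-Uhlenbeck process. -/
noncomputable def statCov (θ α w : ℝ) : ℝ :=
  -(1 / 2) * ∫ p : ℝ × ℝ, (|w| ^ α - |w - p.1| ^ α - |w + p.2| ^ α + |w + p.2 - p.1| ^ α)
    ∂((expMeasure θ).prod (expMeasure θ))

/-- Contribution of the kernel `(s + t)^α` to the covariance. -/
noncomputable def sumCov (θ α w : ℝ) : ℝ :=
  -(1 / 2) * ∫ p : ℝ × ℝ, (|w| ^ α - |w - p.1| ^ α - |w - p.2| ^ α + |w - p.2 - p.1| ^ α)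
    ∂((expMeasure θ).prod (expMeasure θ))

/-- Changing the sign of w amounts to exchanging the two independent exponential variables. -/
lemma statCov_neg (hθ : 0 < θ) (α w : ℝ) : statCov θ α (-w) = statCov θ α w := by
  have := isProbabilityMeasure_expMeasure hθ
  rw [statCov, statCov, ← integral_prod_swap]
  congr with p
  simp only [Prod.fst_swap, Prod.snd_swap]
  rw [abs_neg, ← abs_neg (-w - p.2), ← abs_neg (-w + p.1), ← abs_neg (-w + p.1 - p.2)]
  ring_nf

lemma integrable_rpow_shift (hθ : 0 < θ) (hα : 0 < α) (hα2 : α ≤ 2) (w : ℝ) :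
    Integrable (fun x => |w - x| ^ α) (expMeasure θ) := by
  have := isProbabilityMeasure_expMeasure hθ
  have h := (integrable_abs_rpow_prod hθ hα hα2 w (-1) 0).integral_prod_left
  refine h.congr (Eventually.of_forall fun x => ?_)
  simp [sub_eq_add_neg]

lemma integrable_stat_aux (hθ : 0 < θ) (hα : 0 < α) (hα2 : α ≤ 2) (w c : ℝ) :
    Integrable (fun p : ℝ × ℝ => |w + c * p.2| ^ α - |w + c * p.2 - p.1| ^ α)
      ((expMeasure θ).prod (expMeasure θ)) := by
  refine ((integrable_abs_rpow_prod hθ hα hα2 w 0 c).sub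
    (integrable_abs_rpow_prod hθ hα hα2 w (-1) c)).congr (Eventually.of_forall fun p => ?_)
  simp only [Pi.sub_apply]
  ring_nf

lemma integrable_powAvg (hθ : 0 < θ) (hα : 0 < α) (hα2 : α ≤ 2) (w c : ℝ) :
    Integrable (fun y => powAvg θ α (w + c * y)) (expMeasure θ) := by
  have := isProbabilityMeasure_expMeasure hθ
  exact (integrable_stat_aux hθ hα hα2 w c).integral_prod_right

/-- By Fubini, averaging the difference of `powAvg` yields a second difference. The sign c = 1
belongs to the kernel in u - v, the sign c = -1 to the kernel in u + v. -/
lemma integral_powAvg_sub (hθ : 0 < θ) (hα : 0 < α) (hα2 : α ≤ 2) (w c : ℝ) :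
    ∫ y, (powAvg θ α w - powAvg θ α (w + c * y)) ∂(expMeasure θ) =
      ∫ p : ℝ × ℝ, (|w| ^ α - |w - p.1| ^ α - |w + c * p.2| ^ α + |w + c * p.2 - p.1| ^ α)
        ∂((expMeasure θ).prod (expMeasure θ)) := by
  have := isProbabilityMeasure_expMeasure hθ
  have h0 := integrable_stat_aux hθ hα hα2 w 0
  have h1 := integrable_stat_aux hθ hα hα2 w c
  simp only [zero_mul, add_zero] at h0
  have hsplit : (fun p : ℝ × ℝ =>
      |w| ^ α - |w - p.1| ^ α - |w + c * p.2| ^ α + |w + c * p.2 - p.1| ^ α) = fun p =>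
      (|w| ^ α - |w - p.1| ^ α) - (|w + c * p.2| ^ α - |w + c * p.2 - p.1| ^ α) := by
    ext p
    ring
  rw [hsplit, integral_sub h0 h1, integral_sub (integrable_const _) (integrable_powAvg hθ hα hα2 w c),
    integral_prod_symm _ h0, integral_prod_symm _ h1]
  simp only [powAvg, integral_const, probReal_univ, one_smul]

lemma integral_powAvg_sub_add (hθ : 0 < θ) (hα : 0 < α) (hα2 : α ≤ 2) (w : ℝ) :
    ∫ y, (powAvg θ α w - powAvg θ α (w + y)) ∂(expMeasure θ) = -2 * statCov θ α w := by
  have h := integral_powAvg_sub hθ hα hα2 w 1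
  simp only [one_mul] at h
  rw [h, statCov]
  ring

lemma integral_powAvg_sub_sub (hθ : 0 < θ) (hα : 0 < α) (hα2 : α ≤ 2) (w : ℝ) :
    ∫ y, (powAvg θ α w - powAvg θ α (w - y)) ∂(expMeasure θ) = -2 * sumCov θ α w := by
  have h := integral_powAvg_sub hθ hα hα2 w (-1)
  simp only [neg_mul, one_mul, ← sub_eq_add_neg] at h
  rw [h, sumCov]
  ring

lemma ouFunctional_rpow_sub (hθ : 0 < θ) (hα : 0 < α) (hα2 : α ≤ 2) {T s : ℝ} (h : T ≤ s)
    (v : ℝ) : ouFunctional θ T s (fun u => |u - v| ^ α) =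
      powAvg θ α (s - v) - Real.exp (-θ * (s - T)) * powAvg θ α (T - v) := by
  rw [ouFunctional_eq hθ h]
  · simp only [powAvg, sub_right_comm]
  · simpa only [sub_right_comm] using integrable_rpow_shift hθ hα hα2 (s - v)
  · simpa only [sub_right_comm] using integrable_rpow_shift hθ hα hα2 (T - v)

/-- The function of `r` arising as the image of the kernel in its first variable. -/
noncomputable def innerKernel (θ α ε e c s T r : ℝ) : ℝ :=
  c + (-(1 / 2) * (powAvg θ α (s - r) - e * powAvg θ α (T - r)) +
    -(ε / 2) * (powAvg θ α (s + r) - e * powAvg θ α (T + r)))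

lemma integrable_powAvg_add (hθ : 0 < θ) (hα : 0 < α) (hα2 : α ≤ 2) (w : ℝ) :
    Integrable (fun y => powAvg θ α (w + y)) (expMeasure θ) := by
  simpa using integrable_powAvg hθ hα hα2 w 1

lemma integrable_powAvg_sub (hθ : 0 < θ) (hα : 0 < α) (hα2 : α ≤ 2) (w : ℝ) :
    Integrable (fun y => powAvg θ α (w - y)) (expMeasure θ) := by
  simpa [← sub_eq_add_neg] using integrable_powAvg hθ hα hα2 w (-1)

lemma integrable_innerKernel (hθ : 0 < θ) (hα : 0 < α) (hα2 : α ≤ 2) (ε e c s T r : ℝ) :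
    Integrable (fun y => innerKernel θ α ε e c s T (r - y)) (expMeasure θ) := by
  have := isProbabilityMeasure_expMeasure hθ
  have h1 := (integrable_powAvg_add hθ hα hα2 (s - r)).sub
    ((integrable_powAvg_add hθ hα hα2 (T - r)).const_mul e)
  have h2 := (integrable_powAvg_sub hθ hα hα2 (s + r)).sub
    ((integrable_powAvg_sub hθ hα hα2 (T + r)).const_mul e)
  refine ((integrable_const c).add ((h1.const_mul (-(1 / 2))).add
    (h2.const_mul (-(ε / 2))))).congr (Eventually.of_forall fun y => ?_)
  simp only [Pi.add_apply, Pi.sub_apply, innerKernel, sub_add, add_sub_assoc]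

lemma integral_innerKernel_sub (hθ : 0 < θ) (hα : 0 < α) (hα2 : α ≤ 2) (ε e c s T r : ℝ) :
    ∫ y, (innerKernel θ α ε e c s T r - innerKernel θ α ε e c s T (r - y)) ∂(expMeasure θ) =
      statCov θ α (s - r) - e * statCov θ α (T - r) +
        ε * (sumCov θ α (s + r) - e * sumCov θ α (T + r)) := by
  have := isProbabilityMeasure_expMeasure hθ
  have k1 (a w : ℝ) : Integrable (fun y => a * (powAvg θ α w - powAvg θ α (w + y)))
      (expMeasure θ) :=
    ((integrable_const _).sub (integrable_powAvg_add hθ hα hα2 w)).const_mul a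
  have k2 (a w : ℝ) : Integrable (fun y => a * (powAvg θ α w - powAvg θ α (w - y)))
      (expMeasure θ) :=
    ((integrable_const _).sub (integrable_powAvg_sub hθ hα hα2 w)).const_mul a
  have hsplit : (fun y => innerKernel θ α ε e c s T r - innerKernel θ α ε e c s T (r - y)) =
      fun y => (-(1 / 2) * (powAvg θ α (s - r) - powAvg θ α (s - r + y)) +
        e / 2 * (powAvg θ α (T - r) - powAvg θ α (T - r + y))) +
      (-(ε / 2) * (powAvg θ α (s + r) - powAvg θ α (s + r - y)) +
        ε * e / 2 * (powAvg θ α (T + r) - powAvg θ α (T + r - y))) := by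
    ext y
    rw [innerKernel, innerKernel, ← sub_add s r y, ← sub_add T r y, ← add_sub_assoc,
      ← add_sub_assoc]
    ring
  rw [hsplit, integral_add (by exact (k1 _ _).add (k1 _ _)) (by exact (k2 _ _).add (k2 _ _)),
    integral_add (k1 _ _) (k1 _ _), integral_add (k2 _ _) (k2 _ _)]
  simp only [integral_const_mul, integral_powAvg_sub_add hθ hα hα2,
    integral_powAvg_sub_sub hθ hα hα2]
  ring

/-- Image of the kernel `h₁(u) + h₂(v) - (|u - v|^α + ε |u + v|^α) / 2` under the functional in
both variables. -/
lemma ouFunctional_ouFunctional (hθ : 0 < θ) (hα : 0 < α) (hα2 : α ≤ 2) {T s t : ℝ} (hs : T ≤ s)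
    (ht : T ≤ t) (ε : ℝ) {h₁ : ℝ → ℝ} (h₂ : ℝ → ℝ) (hh₁ : Continuous h₁) :
    (ouFunctional θ T t fun v => ouFunctional θ T s fun u =>
      h₁ u + h₂ v + (-(1 / 2) * |u - v| ^ α + -(ε / 2) * |u + v| ^ α)) =
    statCov θ α (t - s) - Real.exp (-θ * (t - T)) * statCov θ α (s - T) -
      Real.exp (-θ * (s - T)) * statCov θ α (t - T) +
      Real.exp (-θ * (s - T)) * Real.exp (-θ * (t - T)) * statCov θ α 0 +
    ε * (sumCov θ α (s + t) - Real.exp (-θ * (t - T)) * sumCov θ α (s + T) -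
      Real.exp (-θ * (s - T)) * sumCov θ α (t + T) +
      Real.exp (-θ * (s - T)) * Real.exp (-θ * (t - T)) * sumCov θ α (T + T)) := by
  have hcont (v : ℝ) : Continuous fun u : ℝ => |u - v| ^ α :=
    Continuous.rpow_const (by fun_prop) fun _ => Or.inr hα.le
  have hcont' (v : ℝ) : Continuous fun u : ℝ => |u + v| ^ α :=
    Continuous.rpow_const (by fun_prop) fun _ => Or.inr hα.le
  -- The functional in u annihilates h₂(v), and the image of h₁ is a constant in v that disappears
  -- at the second application.
  have hinner (v : ℝ) : (ouFunctional θ T s fun u =>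
      h₁ u + h₂ v + (-(1 / 2) * |u - v| ^ α + -(ε / 2) * |u + v| ^ α)) =
      innerKernel θ α ε (Real.exp (-θ * (s - T))) (ouFunctional θ T s h₁) s T v := by
    have h3 := ouFunctional_rpow_sub hθ hα hα2 hs (-v)
    simp only [sub_neg_eq_add] at h3
    have a1 := ouFunctional_add θ T s (f := fun u => h₁ u + h₂ v)
      (g := fun u => -(1 / 2) * |u - v| ^ α + -(ε / 2) * |u + v| ^ α)
      (hh₁.add continuous_const)
      ((continuous_const.mul (hcont v)).add (continuous_const.mul (hcont' v)))
    have a2 := ouFunctional_add θ T s (f := h₁) (g := fun _ => h₂ v) hh₁ continuous_const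
    have a3 := ouFunctional_add θ T s (f := fun u => -(1 / 2) * |u - v| ^ α)
      (g := fun u => -(ε / 2) * |u + v| ^ α)
      (continuous_const.mul (hcont v)) (continuous_const.mul (hcont' v))
    rw [a1, a2, a3, ouFunctional_const, ouFunctional_const_mul, ouFunctional_const_mul,
      ouFunctional_rpow_sub hθ hα hα2 hs v, h3, add_zero, innerKernel]
  simp only [hinner]
  rw [ouFunctional_eq hθ ht (integrable_innerKernel hθ hα hα2 _ _ _ _ _ _)
      (integrable_innerKernel hθ hα hα2 _ _ _ _ _ _), integral_innerKernel_sub hθ hα hα2,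
    integral_innerKernel_sub hθ hα hα2, ← statCov_neg hθ α (s - t),
    ← statCov_neg hθ α (T - t), neg_sub, neg_sub, sub_self, add_comm T t]
  ring

end PowerKernel

/-! ### Taylor expansion of the second differences -/

section Asymptotics

lemma abs_le_of_hasDerivAt_of_le {F F' : ℝ → ℝ} {K r : ℝ} {n : ℕ} (hF : F 0 = 0)
    (hd : ∀ x, |x| ≤ r → HasDerivAt F (F' x) x) (hb : ∀ x, |x| ≤ r → |F' x| ≤ K * |x| ^ n)
    (hK : 0 ≤ K) {x : ℝ} (hx : |x| ≤ r) : |F x| ≤ K * |x| ^ (n + 1) := by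
  have hle (y : ℝ) (hy : y ∈ Metric.closedBall (0 : ℝ) |x|) : |y| ≤ |x| := by
    simpa using hy
  have h := (convex_closedBall (0 : ℝ) |x|).norm_image_sub_le_of_norm_hasDerivWithin_le
    (f := F) (f' := F') (C := K * |x| ^ n) (x := 0) (y := x)
    (fun y hy => (hd y ((hle y hy).trans hx)).hasDerivWithinAt)
    (fun y hy => (hb y ((hle y hy).trans hx)).trans (by have := hle y hy; gcongr))
    (by simp) (by simp)
  rw [hF, sub_zero, sub_zero, Real.norm_eq_abs, Real.norm_eq_abs] at h
  rwa [pow_succ, ← mul_assoc]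

/-- The third derivative is bounded for |x| ≤ 1/2, since 1 + x ≥ 1/2 and α - 3 < 0. Three uses of
the mean value inequality, starting from 0, raise this bound to order |x|³. -/
lemma abs_one_add_rpow_sub_le_of_small (α : ℝ) (hα : α ≤ 2) {x : ℝ} (hx : |x| ≤ 1 / 2) :
    |(1 + x) ^ α - (1 + α * x + α * (α - 1) / 2 * x ^ 2)| ≤
      |α * (α - 1) * (α - 2)| * (1 / 2) ^ (α - 3) * |x| ^ 3 := by
  have hne (y : ℝ) (hy : |y| ≤ 1 / 2) : 0 < 1 + y := by linarith [(abs_le.1 hy).1]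
  have hbase (a y : ℝ) (hy : |y| ≤ 1 / 2) :
      HasDerivAt (fun y => (1 + y) ^ a) (a * (1 + y) ^ (a - 1)) y := by
    refine (((hasDerivAt_id y).const_add 1).rpow_const (Or.inl (hne y hy).ne')).congr_deriv ?_
    simp
  set K := |α * (α - 1) * (α - 2)| * (1 / 2) ^ (α - 3) with hK
  have hK0 : 0 ≤ K := by positivity
  have s3 (y : ℝ) (hy : |y| ≤ 1 / 2) :
      |α * (α - 1) * ((α - 2) * (1 + y) ^ (α - 2 - 1))| ≤ K * |y| ^ 0 := by
    rw [← mul_assoc, abs_mul, pow_zero, mul_one, hK, show α - 2 - 1 = α - 3 by ring,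
      abs_of_pos (Real.rpow_pos_of_pos (hne y hy) _)]
    refine mul_le_mul_of_nonneg_left ?_ (abs_nonneg _)
    exact Real.rpow_le_rpow_of_nonpos (by norm_num) (by linarith [(abs_le.1 hy).1])
      (by linarith)
  have s2 (y : ℝ) (hy : |y| ≤ 1 / 2) :=
    abs_le_of_hasDerivAt_of_le (F := fun y => α * (α - 1) * ((1 + y) ^ (α - 2) - 1))
      (F' := fun y => α * (α - 1) * ((α - 2) * (1 + y) ^ (α - 2 - 1))) (by simp)
      (fun y hy => ((hbase _ y hy).sub_const 1).const_mul _) s3 hK0 hy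
  have s1 (y : ℝ) (hy : |y| ≤ 1 / 2) :=
    abs_le_of_hasDerivAt_of_le (F := fun y => α * ((1 + y) ^ (α - 1) - 1 - (α - 1) * y))
      (F' := fun y => α * (α - 1) * ((1 + y) ^ (α - 2) - 1)) (by simp)
      (fun y hy => by
        refine ((((hbase _ y hy).sub_const 1).sub
          ((hasDerivAt_id y).const_mul (α - 1))).const_mul α).congr_deriv ?_
        rw [show α - 1 - 1 = α - 2 by ring]
        ring) s2 hK0 hy
  exact abs_le_of_hasDerivAt_of_le
      (F := fun y => (1 + y) ^ α - (1 + α * y + α * (α - 1) / 2 * y ^ 2))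
      (F' := fun y => α * ((1 + y) ^ (α - 1) - 1 - (α - 1) * y)) (by simp)
      (fun y hy => by
        refine ((hbase _ y hy).sub (((hasDerivAt_const y 1).add
          ((hasDerivAt_id y).const_mul α)).add
          (((hasDerivAt_id y).pow 2).const_mul (α * (α - 1) / 2)))).congr_deriv ?_
        simp
        ring) s1 hK0 hx

/-- Second order expansion of `|1 + x|^α`, with a cubic remainder for all real `x`. -/
lemma exists_abs_one_add_rpow_sub_le {α : ℝ} (hα : 0 < α) (hα2 : α ≤ 2) :
    ∃ K : ℝ, 0 < K ∧ ∀ x : ℝ,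
      |(|1 + x| ^ α) - (1 + α * x + α * (α - 1) / 2 * x ^ 2)| ≤ K * |x| ^ 3 := by
  -- The first summand is the constant for |x| ≤ 1/2. The 60 is a generous bound for |x| > 1/2,
  -- where 1, |x| and x² are all multiples of |x|³ at most.
  refine ⟨|α * (α - 1) * (α - 2)| * (1 / 2) ^ (α - 3) + 60, by positivity, fun x => ?_⟩
  have hx3 : 0 ≤ |x| ^ 3 := by positivity
  rcases le_or_gt |x| (1 / 2) with h | h
  · rw [abs_of_pos (show 0 < 1 + x by linarith [(abs_le.1 h).1])]
    nlinarith [abs_one_add_rpow_sub_le_of_small α hα2 h]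
  · have h0 := abs_rpow_le hα.le hα2 (1 + x)
    have h0' : 0 ≤ |1 + x| ^ α := by positivity
    have h1 : 1 ≤ 8 * |x| ^ 3 := by nlinarith [sq_nonneg (|x|), sq_nonneg (|x| - 1 / 2)]
    have h2 : |x| ≤ 4 * |x| ^ 3 := by nlinarith [sq_nonneg (|x|), sq_nonneg (|x| - 1 / 2)]
    have h3 : x ^ 2 ≤ 2 * |x| ^ 3 := by
      rw [← sq_abs]
      nlinarith [sq_nonneg (|x|)]
    have h4 : |α * x| ≤ 8 * |x| ^ 3 := by
      rw [abs_mul, abs_of_pos hα]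
      nlinarith [abs_nonneg x]
    have h5 : |α * (α - 1) / 2 * x ^ 2| ≤ 2 * |x| ^ 3 := by
      rw [abs_mul, abs_of_nonneg (sq_nonneg x)]
      have : |α * (α - 1) / 2| ≤ 1 := abs_le.2 ⟨by nlinarith, by nlinarith⟩
      nlinarith [sq_nonneg x]
    have h6 : 0 ≤ |α * (α - 1) * (α - 2)| * (1 / 2) ^ (α - 3) * |x| ^ 3 := by positivity
    have h7 := abs_le.1 h4
    have h8 := abs_le.1 h5
    have h9 := le_abs_self x
    rw [abs_le]
    constructor <;> nlinarith

/-- Homogeneity: |w + z|^α = w^α |1 + z/w|^α. -/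
lemma exists_abs_rpow_add_sub_le {α : ℝ} (hα : 0 < α) (hα2 : α ≤ 2) :
    ∃ K : ℝ, 0 < K ∧ ∀ w : ℝ, 0 < w → ∀ z : ℝ,
      |(|w + z| ^ α) - (w ^ α + α * w ^ (α - 1) * z + α * (α - 1) / 2 * w ^ (α - 2) * z ^ 2)| ≤
        K * w ^ (α - 3) * |z| ^ 3 := by
  obtain ⟨K, hK, h⟩ := exists_abs_one_add_rpow_sub_le hα hα2
  refine ⟨K, hK, fun w hw z => ?_⟩
  have h1 := mul_le_mul_of_nonneg_left (h (z / w)) (Real.rpow_nonneg hw.le α)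
  rw [← abs_of_nonneg (Real.rpow_nonneg hw.le α), ← abs_mul,
    abs_of_nonneg (Real.rpow_nonneg hw.le α)] at h1
  have e0 : w ^ α * |1 + z / w| ^ α = |w + z| ^ α := by
    rw [← Real.mul_rpow hw.le (abs_nonneg _)]
    congr 1
    nth_rewrite 1 [← abs_of_pos hw]
    rw [← abs_mul]
    congr 1
    field_simp
  have e1 : w ^ (α - 1) = w ^ α / w := Real.rpow_sub_one hw.ne' α
  have e2 : w ^ (α - 2) = w ^ α / w ^ 2 := by
    exact_mod_cast Real.rpow_sub_natCast hw.ne' α 2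
  have e3 : w ^ (α - 3) = w ^ α / w ^ 3 := by
    exact_mod_cast Real.rpow_sub_natCast hw.ne' α 3
  rw [mul_sub, e0] at h1
  rw [e1, e2, e3]
  refine le_trans (le_of_eq (congrArg abs ?_)) (h1.trans (le_of_eq ?_))
  · field_simp
  · rw [abs_div, abs_of_pos hw]
    field_simp

variable {θ α : ℝ}

/-- Asymptotics of the averaged second differences of `|w|^α`. -/
lemma exists_abs_integral_secondDiff_sub_le (hθ : 0 < θ) (hα : 0 < α) (hα2 : α ≤ 2) {σ : ℝ}
    (hσ : |σ| = 1) :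
    ∃ C : ℝ, 0 < C ∧ ∀ w : ℝ, 0 < w →
      |∫ p : ℝ × ℝ, (|w| ^ α - |w - p.1| ^ α - |w + σ * p.2| ^ α + |w + σ * p.2 - p.1| ^ α)
        ∂((expMeasure θ).prod (expMeasure θ)) + σ * (α * (α - 1) / θ ^ 2) * w ^ (α - 2)| ≤
      C * w ^ (α - 3) := by
  have := isProbabilityMeasure_expMeasure hθ
  obtain ⟨K, hK, hT⟩ := exists_abs_rpow_add_sub_le hα hα2
  set W := ∫ p : ℝ × ℝ, ((1 + p.1 ^ 4) * (1 + p.2 ^ 4)) ∂((expMeasure θ).prod (expMeasure θ))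
  have hW : 0 ≤ W := integral_nonneg fun p => by positivity
  refine ⟨9 * K * W + 1, by positivity, fun w hw => ?_⟩
  have hF : Integrable (fun p : ℝ × ℝ =>
      |w| ^ α - |w - p.1| ^ α - |w + σ * p.2| ^ α + |w + σ * p.2 - p.1| ^ α)
      ((expMeasure θ).prod (expMeasure θ)) := by
    have h0 := integrable_stat_aux hθ hα hα2 w 0
    have h1 := integrable_stat_aux hθ hα hα2 w σ
    refine (h0.sub h1).congr (Eventually.of_forall fun p => ?_)
    simp only [Pi.sub_apply, zero_mul, add_zero]
    ring
  have hxy : Integrable (fun p : ℝ × ℝ => σ * (α * (α - 1)) * w ^ (α - 2) * (p.1 * p.2))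
      ((expMeasure θ).prod (expMeasure θ)) := by
    refine Integrable.const_mul ?_ _
    refine integrable_prod_of_le hθ (by fun_prop) 1 fun p => ?_
    have := one_add_sq_add_sq_le p.1 p.2
    rw [abs_le]
    constructor <;> nlinarith [sq_nonneg (p.1 - p.2), sq_nonneg (p.1 + p.2)]
  have hI : ∫ p : ℝ × ℝ, σ * (α * (α - 1)) * w ^ (α - 2) * (p.1 * p.2)
      ∂((expMeasure θ).prod (expMeasure θ)) = σ * (α * (α - 1) / θ ^ 2) * w ^ (α - 2) := by
    rw [integral_const_mul, integral_prod_mul (fun x : ℝ => x) (fun y : ℝ => y),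
      integral_id_expMeasure hθ]
    field_simp
  rw [← hI, ← integral_add hF hxy]
  have hb := norm_integral_le_of_norm_le (((integrable_weight hθ).mul_prod
    (integrable_weight hθ)).const_mul (9 * K * w ^ (α - 3))) (f := fun p : ℝ × ℝ =>
      |w| ^ α - |w - p.1| ^ α - |w + σ * p.2| ^ α + |w + σ * p.2 - p.1| ^ α +
        σ * (α * (α - 1)) * w ^ (α - 2) * (p.1 * p.2)) (Eventually.of_forall fun p => ?_)
  · rw [integral_const_mul] at hb
    refine hb.trans ?_
    have : 0 < w ^ (α - 3) := Real.rpow_pos_of_pos hw _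
    nlinarith
  · obtain ⟨x, y⟩ := p
    simp only
    have t1 := hT w hw (-x)
    have t2 := hT w hw (σ * y)
    have t3 := hT w hw (σ * y - x)
    rw [← sub_eq_add_neg] at t1
    rw [← add_sub_assoc] at t3
    rw [abs_of_pos hw, Real.norm_eq_abs]
    have hsq : σ ^ 2 = 1 := by rw [← sq_abs, hσ, one_pow]
    have cube (z : ℝ) : |z| ^ 3 ≤ 1 + z ^ 4 := by
      have h4 : z ^ 4 = |z| ^ 4 := (Even.pow_abs (by decide) z).symm
      rw [h4]
      have h0 := abs_nonneg z
      nlinarith [sq_nonneg (|z| ^ 2 - |z|), sq_nonneg (|z| - 1), sq_nonneg (|z| ^ 2)]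
    have c1 : |(-x)| ^ 3 ≤ 1 + x ^ 4 := by simpa using cube x
    have c2 : |σ * y| ^ 3 ≤ 1 + y ^ 4 := by simpa [abs_mul, hσ] using cube y
    have c3 : |σ * y - x| ^ 3 ≤ 1 + 8 * (x ^ 4 + y ^ 4) := by
      refine (cube _).trans ?_
      have hy4 : y ^ 4 = (σ * y) ^ 4 := by
        rw [mul_pow, show σ ^ 4 = (σ ^ 2) ^ 2 by ring, hsq]
        ring
      rw [hy4]
      set z := σ * y
      have q1 : (z - x) ^ 2 ≤ 2 * (x ^ 2 + z ^ 2) := by nlinarith [sq_nonneg (z + x)]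
      have q2 : ((z - x) ^ 2) ^ 2 ≤ (2 * (x ^ 2 + z ^ 2)) ^ 2 :=
        pow_le_pow_left₀ (sq_nonneg _) q1 2
      nlinarith [sq_nonneg (x ^ 2 - z ^ 2)]
    have hKw : 0 < K * w ^ (α - 3) := mul_pos hK (Real.rpow_pos_of_pos hw _)
    have hsum : |(-x)| ^ 3 + |σ * y| ^ 3 + |σ * y - x| ^ 3 ≤
        9 * ((1 + x ^ 4) * (1 + y ^ 4)) := by
      have : 0 ≤ x ^ 4 * y ^ 4 := by positivity
      nlinarith
    have hsum' := mul_le_mul_of_nonneg_left hsum hKw.le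
    refine le_trans ?_ (hsum'.trans (by linarith))
    -- In the second difference the constant, linear and pure square terms cancel. Only -σ α(α-1)
    -- w^{α-2} xy survives, and xy has mean 1/θ²; three cubic remainders are left.
    have e : w ^ α - |w - x| ^ α - |w + σ * y| ^ α + |w + σ * y - x| ^ α +
        σ * (α * (α - 1)) * w ^ (α - 2) * (x * y) =
        -(|w - x| ^ α - (w ^ α + α * w ^ (α - 1) * -x +
          α * (α - 1) / 2 * w ^ (α - 2) * (-x) ^ 2)) -
        (|w + σ * y| ^ α - (w ^ α + α * w ^ (α - 1) * (σ * y) +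
          α * (α - 1) / 2 * w ^ (α - 2) * (σ * y) ^ 2)) +
        (|w + σ * y - x| ^ α - (w ^ α + α * w ^ (α - 1) * (σ * y - x) +
          α * (α - 1) / 2 * w ^ (α - 2) * (σ * y - x) ^ 2)) := by ring
    rw [e]
    refine (abs_add_le _ _).trans ((add_le_add_left (abs_sub _ _) _).trans ?_)
    rw [abs_neg]
    linarith

lemma exists_abs_statCov_sub_le (hθ : 0 < θ) (hα : 0 < α) (hα2 : α ≤ 2) :
    ∃ C : ℝ, 0 < C ∧ ∀ w : ℝ, 0 < w →
      |statCov θ α w - α * (α - 1) / (2 * θ ^ 2) * w ^ (α - 2)| ≤ C * w ^ (α - 3) := by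
  obtain ⟨C, hC, h⟩ := exists_abs_integral_secondDiff_sub_le hθ hα hα2 (σ := 1) (by simp)
  refine ⟨C, hC, fun w hw => ?_⟩
  have h1 := h w hw
  simp only [one_mul] at h1
  rw [statCov]
  set I := ∫ p : ℝ × ℝ, (|w| ^ α - |w - p.1| ^ α - |w + p.2| ^ α + |w + p.2 - p.1| ^ α)
    ∂((expMeasure θ).prod (expMeasure θ))
  rw [show -(1 / 2) * I - α * (α - 1) / (2 * θ ^ 2) * w ^ (α - 2) =
    -(1 / 2) * (I + α * (α - 1) / θ ^ 2 * w ^ (α - 2)) by field_simp; ring, abs_mul]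
  have h2 := abs_nonneg (I + α * (α - 1) / θ ^ 2 * w ^ (α - 2))
  norm_num
  linarith

lemma exists_abs_sumCov_add_le (hθ : 0 < θ) (hα : 0 < α) (hα2 : α ≤ 2) :
    ∃ C : ℝ, 0 < C ∧ ∀ w : ℝ, 0 < w →
      |sumCov θ α w + α * (α - 1) / (2 * θ ^ 2) * w ^ (α - 2)| ≤ C * w ^ (α - 3) := by
  obtain ⟨C, hC, h⟩ := exists_abs_integral_secondDiff_sub_le hθ hα hα2 (σ := -1) (by simp)
  refine ⟨C, hC, fun w hw => ?_⟩
  have h1 := h w hw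
  simp only [neg_mul, one_mul, ← sub_eq_add_neg] at h1
  rw [sumCov]
  set I := ∫ p : ℝ × ℝ, (|w| ^ α - |w - p.1| ^ α - |w - p.2| ^ α + |w - p.2 - p.1| ^ α)
    ∂((expMeasure θ).prod (expMeasure θ))
  rw [show -(1 / 2) * I + α * (α - 1) / (2 * θ ^ 2) * w ^ (α - 2) =
    -(1 / 2) * (I - α * (α - 1) / θ ^ 2 * w ^ (α - 2)) by field_simp; ring, abs_mul]
  have h2 := abs_nonneg (I - α * (α - 1) / θ ^ 2 * w ^ (α - 2))
  norm_num
  linarith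

end Asymptotics

/-! ### The stationary variance -/

section VarianceAtZero

variable {θ α : ℝ}

/-- Two independent exponential variables have a difference of the same absolute law. -/
lemma integral_abs_sub_rpow (hθ : 0 < θ) (hα : 0 < α) (hα2 : α ≤ 2) :
    ∫ p : ℝ × ℝ, |p.2 - p.1| ^ α ∂((expMeasure θ).prod (expMeasure θ)) =
      ∫ x, |x| ^ α ∂(expMeasure θ) := by
  have := isProbabilityMeasure_expMeasure hθ
  set h : ℝ → ℝ := (Set.Ioi 0).indicator fun z => |z| ^ α with hh
  set m := ∫ x, |x| ^ α ∂(expMeasure θ) with hm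
  have hmeas : Measurable h :=
    Measurable.indicator (continuous_abs.rpow_const fun _ => Or.inr hα.le).measurable
      measurableSet_Ioi
  have hle (z : ℝ) : ‖h z‖ ≤ |z| ^ α := by
    rw [hh]
    refine (norm_indicator_le_norm_self _ z).trans ?_
    rw [Real.norm_of_nonneg (by positivity)]
  have hsplit (z : ℝ) : |z| ^ α = h z + h (-z) := by
    rcases lt_trichotomy z 0 with hz | rfl | hz
    · simp [hh, hz, hz.le]
    · simp [hh, Real.zero_rpow hα.ne']
    · simp [hh, hz, hz.le]
  have hint : Integrable (fun p : ℝ × ℝ => h (p.2 - p.1))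
      ((expMeasure θ).prod (expMeasure θ)) := by
    refine (integrable_abs_rpow_prod hθ hα hα2 0 (-1) 1).mono'
      (hmeas.comp (measurable_snd.sub measurable_fst)).aestronglyMeasurable
      (Eventually.of_forall fun p => (hle _).trans (le_of_eq ?_))
    congr 2
    ring
  -- Given x, the second variable exceeds x with probability e^{-θx}, and the excess is again
  -- exponential; averaging e^{-θx} over x gives 1/2.
  have hone : ∫ p : ℝ × ℝ, h (p.2 - p.1) ∂((expMeasure θ).prod (expMeasure θ)) = m / 2 := by
    rw [integral_prod _ hint, integral_expMeasure hθ]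
    have hinner (x : ℝ) (hx : 0 < x) :
        ∫ y, h (y - x) ∂(expMeasure θ) = Real.exp (-θ * x) * m := by
      have e1 : (fun y => θ * Real.exp (-θ * y) * h (y - x)) =
          (Set.Ioi x).indicator fun y => θ * Real.exp (-θ * y) * |y - x| ^ α := by
        ext y
        by_cases hy : x < y
        · simp [hh, hy]
        · simp [hh, hy]
      rw [integral_expMeasure hθ, e1, setIntegral_indicator measurableSet_Ioi,
        Set.Ioi_inter_Ioi, max_eq_right hx.le, setIntegral_Ioi_shift, hm, integral_expMeasure hθ,
        ← integral_const_mul]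
      congr with y
      rw [show -θ * (y + x) = -θ * x + -θ * y by ring, Real.exp_add, add_sub_cancel_right]
      ring
    have e2 : ∫ x in Set.Ioi (0 : ℝ), θ * Real.exp (-θ * x) * ∫ y, h (y - x) ∂(expMeasure θ) =
        ∫ x in Set.Ioi (0 : ℝ), θ * m * Real.exp (-(2 * θ) * x) := by
      refine setIntegral_congr_fun measurableSet_Ioi fun x hx => ?_
      rw [hinner x hx, show -(2 * θ) * x = -θ * x + -θ * x by ring, Real.exp_add]
      ring
    rw [e2, integral_const_mul, integral_exp_mul_Ioi (by linarith)]
    simp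
    field_simp
  have htwo : ∫ p : ℝ × ℝ, h (p.1 - p.2) ∂((expMeasure θ).prod (expMeasure θ)) = m / 2 := by
    rw [← hone, ← integral_prod_swap]
    rfl
  have hint' : Integrable (fun p : ℝ × ℝ => h (p.1 - p.2))
      ((expMeasure θ).prod (expMeasure θ)) := hint.swap
  have e3 : (fun p : ℝ × ℝ => |p.2 - p.1| ^ α) = fun p => h (p.2 - p.1) + h (p.1 - p.2) := by
    ext p
    rw [hsplit, neg_sub]
  rw [e3, integral_add hint hint', hone, htwo]
  ring

/-- With independent exponential ξ and η, E|ξ|^α + E|η|^α - E|η-ξ|^α equals a single moment E|ξ|^α,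
half of which remains. -/
lemma statCov_zero (hθ : 0 < θ) (hα : 0 < α) (hα2 : α ≤ 2) :
    statCov θ α 0 = Real.Gamma (α + 1) / (2 * θ ^ α) := by
  have := isProbabilityMeasure_expMeasure hθ
  have h1 := integral_abs_rpow_expMeasure hθ hα.le
  have i1 : Integrable (fun p : ℝ × ℝ => |p.1| ^ α) ((expMeasure θ).prod (expMeasure θ)) :=
    (integrable_abs_rpow_expMeasure hθ hα.le).comp_fst _
  have i2 : Integrable (fun p : ℝ × ℝ => |p.2| ^ α) ((expMeasure θ).prod (expMeasure θ)) :=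
    (integrable_abs_rpow_expMeasure hθ hα.le).comp_snd _
  have i3 : Integrable (fun p : ℝ × ℝ => |p.2 - p.1| ^ α)
      ((expMeasure θ).prod (expMeasure θ)) :=
    (integrable_abs_rpow_prod hθ hα hα2 0 (-1) 1).congr
      (Eventually.of_forall fun p => by simp only; ring_nf)
  have j1 : ∫ p : ℝ × ℝ, |p.1| ^ α ∂((expMeasure θ).prod (expMeasure θ)) =
      ∫ x, |x| ^ α ∂(expMeasure θ) := by
    simpa using integral_fun_fst (μ := expMeasure θ) (ν := expMeasure θ) fun x : ℝ => |x| ^ α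
  have j2 : ∫ p : ℝ × ℝ, |p.2| ^ α ∂((expMeasure θ).prod (expMeasure θ)) =
      ∫ x, |x| ^ α ∂(expMeasure θ) := by
    simpa using integral_fun_snd (μ := expMeasure θ) (ν := expMeasure θ) fun x : ℝ => |x| ^ α
  have e : (fun p : ℝ × ℝ => |(0 : ℝ)| ^ α - |0 - p.1| ^ α - |0 + p.2| ^ α + |0 + p.2 - p.1| ^ α) =
      fun p => |p.2 - p.1| ^ α - (|p.1| ^ α + |p.2| ^ α) := by
    ext p
    simp only [abs_zero, Real.zero_rpow hα.ne', zero_sub, abs_neg, zero_add]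
    ring
  rw [statCov, e, integral_sub i3 (by exact i1.add i2), integral_add i1 i2, j1, j2,
    integral_abs_sub_rpow hθ hα hα2, h1]
  field_simp
  ring

end VarianceAtZero

/-! ### Partial sums and tails of powers -/

section PowerSums

/-- Bernoulli's inequality for the exponent 1 - s in (0, 1], applied to n/(n+1). Summation makes the
right side telescope. -/
lemma rpow_neg_mul_le_sub {s : ℝ} (hs0 : 0 ≤ s) (hs : s < 1) (n : ℕ) :
    ((n : ℝ) + 1) ^ (-s) * (1 - s) ≤ ((n : ℝ) + 1) ^ (1 - s) - (n : ℝ) ^ (1 - s) := by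
  have hn : (0 : ℝ) < n + 1 := by positivity
  have h1 : -1 ≤ -(1 / ((n : ℝ) + 1)) := by
    rw [neg_le_neg_iff, div_le_one hn]
    linarith [(Nat.cast_nonneg n : (0 : ℝ) ≤ n)]
  have h := rpow_one_add_le_one_add_mul_self h1 (show 0 ≤ 1 - s by linarith) (by linarith)
  have e1 : (n : ℝ) = (n + 1) * (1 + -(1 / ((n : ℝ) + 1))) := by field_simp; ring
  have e2 : (n : ℝ) ^ (1 - s) =
      ((n : ℝ) + 1) ^ (1 - s) * (1 + -(1 / ((n : ℝ) + 1))) ^ (1 - s) := by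
    rw [← Real.mul_rpow hn.le (by linarith), ← e1]
  have e3 : ((n : ℝ) + 1) ^ (1 - s) = ((n : ℝ) + 1) ^ (-s) * (n + 1) := by
    rw [← Real.rpow_add_one hn.ne']
    ring_nf
  have h2 := mul_le_mul_of_nonneg_left h (Real.rpow_nonneg hn.le (1 - s))
  rw [← e2] at h2
  have e4 : ((n : ℝ) + 1) ^ (1 - s) * (1 + (1 - s) * -(1 / ((n : ℝ) + 1))) =
      ((n : ℝ) + 1) ^ (1 - s) - ((n : ℝ) + 1) ^ (-s) * (1 - s) := by
    rw [e3]
    field_simp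
    ring
  linarith

lemma sum_rpow_neg_le {s : ℝ} (hs0 : 0 ≤ s) (hs : s < 1) (n : ℕ) :
    ∑ k ∈ Finset.range n, ((k : ℝ) + 1) ^ (-s) ≤ (n : ℝ) ^ (1 - s) / (1 - s) := by
  rw [le_div_iff₀ (by linarith), Finset.sum_mul]
  refine (Finset.sum_le_sum fun k _ => rpow_neg_mul_le_sub hs0 hs k).trans ?_
  have h := Finset.sum_range_sub (fun k : ℕ => (k : ℝ) ^ (1 - s)) n
  push_cast at h
  rw [h, Real.zero_rpow (by linarith), sub_zero]

/-- The exponent 1 - s is now negative; log y ≤ y - 1 and 1 + y ≤ e^y supply the Bernoulli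
inequality in that range. -/
lemma rpow_neg_mul_le_sub' {s x : ℝ} (hs : 1 < s) (hx : 0 < x) :
    (x + 1) ^ (-s) * (s - 1) ≤ x ^ (1 - s) - (x + 1) ^ (1 - s) := by
  have hx1 : 0 < x + 1 := by linarith
  have h1 : 0 < x / (x + 1) := by positivity
  have hlog := Real.log_le_sub_one_of_pos h1
  have h2 : 1 + (s - 1) * (1 / (x + 1)) ≤ (x / (x + 1)) ^ (1 - s) := by
    rw [Real.rpow_def_of_pos h1]
    have h3 := Real.add_one_le_exp (Real.log (x / (x + 1)) * (1 - s))
    have h4 : x / (x + 1) - 1 = -(1 / (x + 1)) := by field_simp; ring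
    rw [h4] at hlog
    nlinarith
  have e2 : x ^ (1 - s) = (x + 1) ^ (1 - s) * (x / (x + 1)) ^ (1 - s) := by
    rw [← Real.mul_rpow hx1.le h1.le, mul_div_cancel₀ _ hx1.ne']
  have e3 : (x + 1) ^ (1 - s) = (x + 1) ^ (-s) * (x + 1) := by
    rw [← Real.rpow_add_one hx1.ne']
    ring_nf
  have h5 := mul_le_mul_of_nonneg_left h2 (Real.rpow_nonneg hx1.le (1 - s))
  rw [← e2] at h5
  have e4 : (x + 1) ^ (1 - s) * (1 + (s - 1) * (1 / (x + 1))) =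
      (x + 1) ^ (1 - s) + (x + 1) ^ (-s) * (s - 1) := by
    rw [e3]
    field_simp
  linarith

lemma sum_rpow_neg_tail_le {s : ℝ} (hs : 1 < s) (m N : ℕ) :
    ∑ j ∈ Finset.range N, ((m : ℝ) + j + 1 + 1) ^ (-s) ≤ ((m : ℝ) + 1) ^ (1 - s) / (s - 1) := by
  rw [le_div_iff₀ (by linarith), Finset.sum_mul]
  refine (Finset.sum_le_sum fun j _ =>
    rpow_neg_mul_le_sub' hs (by positivity)).trans ?_
  have h := Finset.sum_range_sub' (fun j : ℕ => ((m : ℝ) + j + 1) ^ (1 - s)) N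
  push_cast at h
  simp only [← add_assoc, add_zero] at h
  have h0 : 0 ≤ ((m : ℝ) + N + 1) ^ (1 - s) := by positivity
  rw [h]
  linarith

lemma sum_rpow_neg_le_const {s : ℝ} (hs : 1 < s) (n : ℕ) :
    ∑ k ∈ Finset.range n, ((k : ℝ) + 1) ^ (-s) ≤ 1 + 1 / (s - 1) := by
  have h0 : ∑ k ∈ Finset.range n, ((k : ℝ) + 1) ^ (-s) ≤
      ∑ k ∈ Finset.range (n + 1), ((k : ℝ) + 1) ^ (-s) :=
    Finset.sum_le_sum_of_subset_of_nonneg (Finset.range_mono (Nat.le_succ n))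
      fun _ _ _ => by positivity
  refine h0.trans ?_
  rw [Finset.sum_range_succ']
  have h := sum_rpow_neg_tail_le hs 0 n
  simp only [Nat.cast_zero, zero_add, Real.one_rpow] at h ⊢
  push_cast
  linarith

end PowerSums

/-! ### Double sums of even functions of the index difference -/

section StationarySums

lemma sum_Icc_one_eq_sum_range (f : ℕ → ℝ) (n : ℕ) :
    ∑ i ∈ Finset.Icc 1 n, f i = ∑ i ∈ Finset.range n, f (i + 1) := by
  induction n with
  | zero => simp
  | succ n ih => rw [Finset.sum_Icc_succ_top (by omega), Finset.sum_range_succ, ih]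

lemma sum_range_reflect_sub (F : ℝ → ℝ) (n : ℕ) :
    ∑ j ∈ Finset.range n, F ((n : ℝ) - j) = ∑ k ∈ Finset.range n, F ((k : ℝ) + 1) := by
  rw [← Finset.sum_range_reflect]
  refine Finset.sum_congr rfl fun j hj => ?_
  have : j < n := Finset.mem_range.1 hj
  rw [Nat.cast_sub (by omega), Nat.cast_sub (by omega)]
  push_cast
  ring_nf

/-- Double sums of an even function of the difference of the indices. -/
lemma sum_sum_sub_eq {F : ℝ → ℝ} (hF : ∀ x, F (-x) = F x) (n : ℕ) :
    ∑ i ∈ Finset.range n, ∑ j ∈ Finset.range n, F ((j : ℝ) - i) =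
      n * F 0 + 2 * ∑ m ∈ Finset.range n, ∑ k ∈ Finset.range m, F ((k : ℝ) + 1) := by
  induction n with
  | zero => simp
  | succ n ih =>
    have h1 : ∑ i ∈ Finset.range n, F ((n : ℝ) - i) = ∑ j ∈ Finset.range n, F ((j : ℝ) - n) :=
      Finset.sum_congr rfl fun j _ => by rw [← hF, neg_sub]
    simp only [Finset.sum_range_succ _ n, Finset.sum_add_distrib]
    rw [ih, ← h1, sum_range_reflect_sub]
    push_cast
    simp
    ring

/-- A row splits at the diagonal into two one-sided sums, each at most the full one-sided sum. -/
lemma sum_abs_sub_le {a : ℝ → ℝ} (ha : ∀ x, a (-x) = a x) (ha0 : ∀ x, 0 ≤ a x)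
    (hmono : ∀ k : ℕ, a ((k : ℝ) + 1) ≤ a k) {i n : ℕ} (hi : i ≤ n) :
    ∑ j ∈ Finset.range n, a ((j : ℝ) - i) ≤ 2 * ∑ k ∈ Finset.range n, a k := by
  obtain ⟨m, rfl⟩ := Nat.exists_eq_add_of_le hi
  have hsub (r : ℕ) (hr : r ≤ i + m) :
      ∑ k ∈ Finset.range r, a k ≤ ∑ k ∈ Finset.range (i + m), a k :=
    Finset.sum_le_sum_of_subset_of_nonneg (Finset.range_mono hr) fun _ _ _ => ha0 _
  have h1 : ∑ j ∈ Finset.range i, a ((j : ℝ) - i) ≤ ∑ k ∈ Finset.range i, a k := by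
    rw [Finset.sum_congr rfl fun (j : ℕ) _ => (by rw [← ha, neg_sub] :
      a ((j : ℝ) - i) = a ((i : ℝ) - j)), sum_range_reflect_sub]
    exact Finset.sum_le_sum fun k _ => hmono k
  rw [Finset.sum_range_add]
  simp only [Nat.cast_add, add_sub_cancel_left]
  linarith [hsub i (by omega), hsub m (by omega)]

/-- The stationary part of the double sum, compared with its asymptotic value. -/
lemma abs_sum_sum_sub_le {F : ℝ → ℝ} (hF : ∀ x, F (-x) = F x) (hF0 : ∀ x, 0 ≤ F x) {C s : ℝ}
    (hs : 1 < s) (hb : ∀ k : ℕ, F k ≤ C * ((k : ℝ) + 1) ^ (-s)) (n : ℕ) :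
    Summable (fun k : ℕ => F ((k : ℝ) + 1)) ∧
    |∑ i ∈ Finset.range n, ∑ j ∈ Finset.range n, F ((j : ℝ) - i) -
      n * (F 0 + 2 * ∑' k : ℕ, F ((k : ℝ) + 1))| ≤
      2 * (C / (s - 1)) * ∑ m ∈ Finset.range n, ((m : ℝ) + 1) ^ (1 - s) := by
  have hC : 0 ≤ C := by
    have := (hF0 0).trans (by simpa using hb 0)
    linarith
  have htail (m N : ℕ) : ∑ j ∈ Finset.range N, F (((j + m : ℕ) : ℝ) + 1) ≤
      C / (s - 1) * ((m : ℝ) + 1) ^ (1 - s) := by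
    have h1 := mul_le_mul_of_nonneg_left (sum_rpow_neg_tail_le hs m N) hC
    rw [Finset.mul_sum] at h1
    refine (Finset.sum_le_sum fun j _ => ?_).trans (h1.trans (le_of_eq (by ring)))
    have h2 := hb (j + m + 1)
    push_cast at h2 ⊢
    rwa [add_comm (j : ℝ) m] at h2 ⊢
  have hsum : Summable (fun k : ℕ => F ((k : ℝ) + 1)) :=
    summable_of_sum_range_le (fun k => hF0 _) (fun N => by simpa using htail 0 N)
  refine ⟨hsum, ?_⟩
  have hsplit (m : ℕ) := hsum.sum_add_tsum_nat_add m
  have htt (m : ℕ) : ∑' j : ℕ, F (((j + m : ℕ) : ℝ) + 1) ≤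
      C / (s - 1) * ((m : ℝ) + 1) ^ (1 - s) :=
    Real.tsum_le_of_sum_range_le (fun k => hF0 _) (htail m)
  -- The error is exact: each partial sum differs from the full series by its tail, so minus twice
  -- the sum of the tails remains.
  have e : ∑ i ∈ Finset.range n, ∑ j ∈ Finset.range n, F ((j : ℝ) - i) -
      n * (F 0 + 2 * ∑' k : ℕ, F ((k : ℝ) + 1)) =
      -(2 * ∑ m ∈ Finset.range n, ∑' j : ℕ, F (((j + m : ℕ) : ℝ) + 1)) := by
    have h3 : ∑ m ∈ Finset.range n, ∑ k ∈ Finset.range m, F ((k : ℝ) + 1) +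
        ∑ m ∈ Finset.range n, ∑' j : ℕ, F (((j + m : ℕ) : ℝ) + 1) =
        n * ∑' k : ℕ, F ((k : ℝ) + 1) := by
      rw [← Finset.sum_add_distrib, Finset.sum_congr rfl fun m _ => hsplit m]
      simp
    rw [sum_sum_sub_eq hF]
    linarith
  rw [e, abs_neg, abs_of_nonneg (mul_nonneg zero_le_two (Finset.sum_nonneg fun m _ =>
    tsum_nonneg fun j => hF0 _)), mul_assoc, Finset.mul_sum _ _ (C / (s - 1))]
  exact mul_le_mul_of_nonneg_left (Finset.sum_le_sum fun m _ => htt m) zero_le_two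

end StationarySums

/-! ### Decay of the covariances and comparison with the stationary case -/

section CovarianceSums

variable {θ α γ : ℝ}

/-- The deviation of the covariance of the solution from the stationary one. -/
noncomputable def covDeviation (θ α s t : ℝ) : ℝ :=
  sumCov θ α (s + t) - Real.exp (-θ * t) * (statCov θ α s + sumCov θ α s) -
    Real.exp (-θ * s) * (statCov θ α t + sumCov θ α t) +
    Real.exp (-θ * s) * Real.exp (-θ * t) * (statCov θ α 0 + sumCov θ α 0)

/-- Covariance of the sub-fractional Ornstein-Uhlenbeck process. -/
noncomputable def ouCov (θ α s t : ℝ) : ℝ := statCov θ α (t - s) + covDeviation θ α s t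

/-- The second alternative serves a vanishing leading coefficient, where the remainder of order
w^{α-3} governs the decay. -/
lemma exists_decay_of_asymptotics {f : ℝ → ℝ} {C c : ℝ}
    (hf : ∀ w : ℝ, 0 < w → |f w - c * w ^ (α - 2)| ≤ C * w ^ (α - 3))
    (hγ : γ ≤ 2 - α ∨ (c = 0 ∧ γ ≤ 3 - α)) (hγ0 : 0 ≤ γ) :
    ∃ K : ℝ, 0 < K ∧ ∀ k : ℕ, |f k| ≤ K * ((k : ℝ) + 1) ^ (-γ) := by
  have hC : 0 ≤ C := (abs_nonneg _).trans (by simpa using hf 1 one_pos)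
  -- `|f 0|` covers the index 0, where the expansion says nothing. The factor 2^γ pays for replacing
  -- k by k + 1 when k ≥ 1, and the 1 ensures positivity.
  refine ⟨|f 0| + (|c| + C) * 2 ^ γ + 1, by positivity, fun k => ?_⟩
  rcases Nat.eq_zero_or_pos k with rfl | hk
  · simp only [Nat.cast_zero, zero_add, Real.one_rpow, mul_one]
    have : 0 ≤ (|c| + C) * (2 : ℝ) ^ γ := by positivity
    linarith
  · have hk1 : (1 : ℝ) ≤ k := by exact_mod_cast hk
    have hk0 : (0 : ℝ) < k := by linarith
    have h1 := hf k hk0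
    have h2 : |f k| ≤ |c| * (k : ℝ) ^ (α - 2) + C * (k : ℝ) ^ (α - 3) := by
      have h3 := abs_sub_abs_le_abs_sub (f k) (c * (k : ℝ) ^ (α - 2))
      rw [abs_mul, abs_of_pos (Real.rpow_pos_of_pos hk0 (α - 2))] at h3
      linarith
    have h3 : |f k| ≤ (|c| + C) * (k : ℝ) ^ (-γ) := by
      refine h2.trans ?_
      rw [add_mul]
      refine add_le_add ?_ (mul_le_mul_of_nonneg_left
        (Real.rpow_le_rpow_of_exponent_le hk1 ?_) hC)
      · rcases hγ with h | ⟨h, _⟩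
        · exact mul_le_mul_of_nonneg_left (Real.rpow_le_rpow_of_exponent_le hk1 (by linarith))
            (abs_nonneg _)
        · simp [h]
      · rcases hγ with h | ⟨_, h⟩ <;> linarith
    have h4 : (k : ℝ) ^ (-γ) ≤ 2 ^ γ * ((k : ℝ) + 1) ^ (-γ) := by
      have h5 : ((k : ℝ) + 1) / 2 ≤ k := by linarith
      refine (Real.rpow_le_rpow_of_nonpos (by positivity) h5 (by linarith)).trans (le_of_eq ?_)
      rw [Real.div_rpow (by linarith) (by norm_num), Real.rpow_neg (by norm_num : (0 : ℝ) ≤ 2) γ,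
        div_inv_eq_mul, mul_comm]
    refine h3.trans ((mul_le_mul_of_nonneg_left h4 (by positivity)).trans ?_)
    rw [← mul_assoc]
    refine mul_le_mul_of_nonneg_right ?_ (by positivity)
    linarith [abs_nonneg (f 0)]

/-- Squaring e^{θk/2} ≥ 1 + θk/2 ≥ m(k+1) gives quadratic decay, which suffices because γ ≤ 2. -/
lemma exists_exp_neg_le (hθ : 0 < θ) (hγ : γ ≤ 2) :
    ∃ K : ℝ, 0 < K ∧ ∀ k : ℕ, Real.exp (-θ * k) ≤ K * ((k : ℝ) + 1) ^ (-γ) := by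
  set m := min 1 (θ / 2)
  have hm : 0 < m := lt_min one_pos (by linarith)
  refine ⟨(m ^ 2)⁻¹, by positivity, fun k => ?_⟩
  have hk : (0 : ℝ) ≤ k := Nat.cast_nonneg k
  have h1 : m * (k + 1) ≤ Real.exp (θ * k / 2) := by
    have h2 := Real.add_one_le_exp (θ * k / 2)
    have h3 : m ≤ 1 := min_le_left _ _
    have h4 : m ≤ θ / 2 := min_le_right _ _
    nlinarith
  have h2 : (m * (k + 1)) ^ 2 ≤ Real.exp (θ * k) := by
    refine (pow_le_pow_left₀ (by positivity) h1 2).trans (le_of_eq ?_)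
    rw [← Real.exp_nat_mul]
    push_cast
    ring_nf
  have h3 : ((k : ℝ) + 1) ^ (-2 : ℝ) ≤ ((k : ℝ) + 1) ^ (-γ) :=
    Real.rpow_le_rpow_of_exponent_le (by linarith) (by linarith)
  have h4 : ((k : ℝ) + 1) ^ (-2 : ℝ) = (((k : ℝ) + 1) ^ 2)⁻¹ := by
    rw [Real.rpow_neg (by positivity), Real.rpow_two]
  rw [neg_mul, Real.exp_neg]
  calc (Real.exp (θ * k))⁻¹ ≤ ((m * (k + 1)) ^ 2)⁻¹ := inv_anti₀ (by positivity) h2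
    _ = (m ^ 2)⁻¹ * ((k : ℝ) + 1) ^ (-2 : ℝ) := by rw [h4, mul_pow, mul_inv]
    _ ≤ _ := mul_le_mul_of_nonneg_left h3 (by positivity)

lemma mul_rpow_neg_le (hγ : 0 ≤ γ) (i j : ℕ) :
    ((i : ℝ) + 1) ^ (-γ) * ((j : ℝ) + 1) ^ (-γ) ≤ ((i : ℝ) + j + 1) ^ (-γ) := by
  rw [← Real.mul_rpow (by positivity) (by positivity)]
  refine Real.rpow_le_rpow_of_nonpos (by positivity) ?_ (by linarith)
  have : (0 : ℝ) ≤ i * j := by positivity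
  nlinarith

/-- Decay of the stationary covariance and of the deviation from it. -/
lemma exists_decay (hθ : 0 < θ) (hα : 0 < α) (hα2 : α ≤ 2)
    (hγ : γ = 2 - α ∨ (α = 1 ∧ γ = 2)) :
    ∃ K : ℝ, 0 < K ∧ (∀ k : ℕ, |statCov θ α k| ≤ K * ((k : ℝ) + 1) ^ (-γ)) ∧
      ∀ i j : ℕ, |covDeviation θ α i j| ≤ K * ((i : ℝ) + j + 1) ^ (-γ) := by
  have hγ0 : 0 ≤ γ := by rcases hγ with h | ⟨_, h⟩ <;> linarith
  have hγ2 : γ ≤ 2 := by rcases hγ with h | ⟨_, h⟩ <;> linarith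
  obtain ⟨C₁, _, h₁⟩ := exists_abs_statCov_sub_le hθ hα hα2
  obtain ⟨C₂, _, h₂⟩ := exists_abs_sumCov_add_le hθ hα hα2
  -- For α = 1 the coefficient α(α-1) is zero, so the exponent rises from 1 to 2. This avoids the
  -- logarithm that γ = 1 would produce at H = 1/2.
  have hγ1 : γ ≤ 2 - α ∨ (α * (α - 1) / (2 * θ ^ 2) = 0 ∧ γ ≤ 3 - α) := by
    rcases hγ with h | ⟨h, h'⟩
    · exact Or.inl h.le
    · exact Or.inr ⟨by simp [h], by linarith⟩
  have hγ3 : γ ≤ 2 - α ∨ (-(α * (α - 1) / (2 * θ ^ 2)) = 0 ∧ γ ≤ 3 - α) := by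
    simpa only [neg_eq_zero] using hγ1
  obtain ⟨K₁, hK₁, b₁⟩ := exists_decay_of_asymptotics h₁ hγ1 hγ0
  obtain ⟨K₂, hK₂, b₂⟩ := exists_decay_of_asymptotics (f := sumCov θ α)
    (fun w hw => by simpa only [neg_mul, sub_neg_eq_add] using h₂ w hw) hγ3 hγ0
  obtain ⟨K₃, hK₃, b₃⟩ := exists_exp_neg_le (γ := γ) hθ hγ2
  refine ⟨K₁ + (K₂ + 2 * (K₃ * (K₁ + K₂)) + K₃ * K₃ * (K₁ + K₂)), by positivity,
    fun k => (b₁ k).trans (mul_le_mul_of_nonneg_right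
      (le_add_of_nonneg_right (by positivity)) (by positivity)), fun i j => ?_⟩
  have hl (k : ℕ) : |statCov θ α k + sumCov θ α k| ≤ (K₁ + K₂) * ((k : ℝ) + 1) ^ (-γ) := by
    refine (abs_add_le _ _).trans ?_
    linarith [b₁ k, b₂ k]
  have hl0 : |statCov θ α 0 + sumCov θ α 0| ≤ K₁ + K₂ := by simpa using hl 0
  set A := ((i : ℝ) + 1) ^ (-γ)
  set B := ((j : ℝ) + 1) ^ (-γ)
  set D := ((i : ℝ) + j + 1) ^ (-γ)
  have hA : 0 ≤ A := by positivity
  have hB : 0 ≤ B := by positivity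
  have hAB : A * B ≤ D := mul_rpow_neg_le hγ0 i j
  have t1 : |sumCov θ α ((i : ℝ) + j)| ≤ K₂ * D := by simpa using b₂ (i + j)
  have t2 : |Real.exp (-θ * j) * (statCov θ α i + sumCov θ α i)| ≤ K₃ * (K₁ + K₂) * D := by
    rw [abs_mul, Real.abs_exp]
    calc _ ≤ (K₃ * B) * ((K₁ + K₂) * A) :=
          mul_le_mul (b₃ j) (hl i) (abs_nonneg _) (by positivity)
      _ = K₃ * (K₁ + K₂) * (A * B) := by ring
      _ ≤ _ := mul_le_mul_of_nonneg_left hAB (by positivity)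
  have t3 : |Real.exp (-θ * i) * (statCov θ α j + sumCov θ α j)| ≤ K₃ * (K₁ + K₂) * D := by
    rw [abs_mul, Real.abs_exp]
    calc _ ≤ (K₃ * A) * ((K₁ + K₂) * B) :=
          mul_le_mul (b₃ i) (hl j) (abs_nonneg _) (by positivity)
      _ = K₃ * (K₁ + K₂) * (A * B) := by ring
      _ ≤ _ := mul_le_mul_of_nonneg_left hAB (by positivity)
  have t4 : |Real.exp (-θ * i) * Real.exp (-θ * j) * (statCov θ α 0 + sumCov θ α 0)| ≤
      K₃ * K₃ * (K₁ + K₂) * D := by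
    rw [abs_mul, abs_mul, Real.abs_exp, Real.abs_exp]
    calc _ ≤ (K₃ * A * (K₃ * B)) * (K₁ + K₂) :=
          mul_le_mul (mul_le_mul (b₃ i) (b₃ j) (Real.exp_pos _).le (by positivity)) hl0
            (abs_nonneg _) (by positivity)
      _ = K₃ * K₃ * (K₁ + K₂) * (A * B) := by ring
      _ ≤ _ := mul_le_mul_of_nonneg_left hAB (by positivity)
  have hD : 0 ≤ K₁ * D := by positivity
  rw [covDeviation]
  refine (abs_add_le _ _).trans ((add_le_add_left ((abs_sub _ _).trans
    (add_le_add_left (abs_sub _ _) _)) _).trans ?_)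
  linarith

/-- The squared covariances of the solution at the integers are, in the mean, those of the
stationary process. -/
lemma exists_sum_sum_abs_sub_le (hθ : 0 < θ) (hα : 0 < α) (hα2 : α ≤ 2)
    (hγ : γ = 2 - α ∨ (α = 1 ∧ γ = 2)) :
    ∃ K : ℝ, 0 < K ∧ ∀ n : ℕ,
      |∑ i ∈ Finset.range n, ∑ j ∈ Finset.range n, ouCov θ α ((i : ℝ) + 1) ((j : ℝ) + 1) ^ 2 -
        ∑ i ∈ Finset.range n, ∑ j ∈ Finset.range n, statCov θ α ((j : ℝ) - i) ^ 2| ≤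
      K * (∑ k ∈ Finset.range n, ((k : ℝ) + 1) ^ (-γ)) ^ 2 := by
  have hγ0 : 0 ≤ γ := by rcases hγ with h | ⟨_, h⟩ <;> linarith
  obtain ⟨K, hK, hs, hd⟩ := exists_decay hθ hα hα2 hγ
  refine ⟨6 * K ^ 2, by positivity, fun n => ?_⟩
  set a : ℝ → ℝ := fun x => (|x| + 1) ^ (-γ) with ha
  have ha0 (x : ℝ) : 0 ≤ a x := by positivity
  have hanti {x y : ℝ} (h : |x| ≤ |y|) : a y ≤ a x :=
    Real.rpow_le_rpow_of_nonpos (by positivity) (by linarith) (by linarith)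
  have hak (k : ℕ) : a k = ((k : ℝ) + 1) ^ (-γ) := by simp [ha]
  have hstat (i j : ℕ) : |statCov θ α ((j : ℝ) - i)| ≤ K * a ((j : ℝ) - i) := by
    rcases le_total i j with h | h
    · have := hs (j - i)
      rwa [← hak, Nat.cast_sub h] at this
    · have := hs (i - j)
      rw [← hak, Nat.cast_sub h] at this
      rw [← statCov_neg hθ, neg_sub]
      simpa [ha, abs_sub_comm] using this
  have hterm (i j : ℕ) : |ouCov θ α ((i : ℝ) + 1) ((j : ℝ) + 1) ^ 2 -
      statCov θ α ((j : ℝ) - i) ^ 2| ≤ 3 * K ^ 2 * (a i * a ((j : ℝ) - i)) := by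
    have h1 := hstat i j
    have h2 : |covDeviation θ α ((i : ℝ) + 1) ((j : ℝ) + 1)| ≤ K * a ((i : ℝ) + j) := by
      have h3 := hd (i + 1) (j + 1)
      push_cast at h3
      refine h3.trans (mul_le_mul_of_nonneg_left ?_ hK.le)
      refine Real.rpow_le_rpow_of_nonpos (by positivity) ?_ (by linarith)
      rw [abs_of_nonneg (by positivity)]
      linarith
    have hi0 : (0 : ℝ) ≤ i := Nat.cast_nonneg i
    have hj0 : (0 : ℝ) ≤ j := Nat.cast_nonneg j
    -- Both i and |j-i| are at most i + j. In η(2ρ+η) the first factor is charged to i and the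
    -- second to j - i, so the double sum becomes a sum over i of row sums.
    have h4 : a ((i : ℝ) + j) ≤ a i := hanti (by
      rw [abs_of_nonneg hi0, abs_of_nonneg (by positivity)]; linarith)
    have h5 : a ((i : ℝ) + j) ≤ a ((j : ℝ) - i) := hanti (by
      rw [abs_of_nonneg (show 0 ≤ (i : ℝ) + j by positivity), abs_le]
      constructor <;> linarith)
    rw [ouCov, add_sub_add_right_eq_sub]
    set ρ := statCov θ α ((j : ℝ) - i)
    set η := covDeviation θ α ((i : ℝ) + 1) ((j : ℝ) + 1)
    rw [show (ρ + η) ^ 2 - ρ ^ 2 = η * (2 * ρ + η) by ring, abs_mul]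
    have h6 : |2 * ρ + η| ≤ 3 * K * a ((j : ℝ) - i) := by
      refine (abs_add_le _ _).trans ?_
      rw [abs_mul, abs_two]
      nlinarith
    have h7 : |η| ≤ K * a i := h2.trans (mul_le_mul_of_nonneg_left h4 hK.le)
    calc |η| * |2 * ρ + η| ≤ (K * a i) * (3 * K * a ((j : ℝ) - i)) :=
          mul_le_mul h7 h6 (abs_nonneg _) (mul_nonneg hK.le (ha0 _))
      _ = _ := by ring
  have hrow (i : ℕ) (hi : i ∈ Finset.range n) : ∑ j ∈ Finset.range n, a ((j : ℝ) - i) ≤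
      2 * ∑ k ∈ Finset.range n, a k :=
    sum_abs_sub_le (fun x => by simp [ha]) ha0 (fun k => hanti (by
      rw [Nat.abs_cast, abs_of_nonneg (by positivity)]; linarith)) (Finset.mem_range.1 hi).le
  simp only [← hak]
  rw [← Finset.sum_sub_distrib]
  simp only [← Finset.sum_sub_distrib]
  calc _ ≤ ∑ i ∈ Finset.range n, ∑ j ∈ Finset.range n, 3 * K ^ 2 * (a i * a ((j : ℝ) - i)) :=
        (Finset.abs_sum_le_sum_abs _ _).trans (Finset.sum_le_sum fun i _ =>
          (Finset.abs_sum_le_sum_abs _ _).trans (Finset.sum_le_sum fun j _ => hterm i j))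
    _ = 3 * K ^ 2 * ∑ i ∈ Finset.range n, a i * ∑ j ∈ Finset.range n, a ((j : ℝ) - i) := by
        simp only [Finset.mul_sum]
    _ ≤ 3 * K ^ 2 * ∑ i ∈ Finset.range n, a i * (2 * ∑ k ∈ Finset.range n, a k) :=
        mul_le_mul_of_nonneg_left (Finset.sum_le_sum fun i hi =>
          mul_le_mul_of_nonneg_left (hrow i hi) (ha0 _)) (by positivity)
    _ = _ := by
        rw [← Finset.sum_mul]
        ring

end CovarianceSums

/-! ### Rate of convergence below the critical index -/

section Rates

variable {θ H : ℝ}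

/-- Decay exponents adapted to the rate of convergence. -/
lemma exists_exponent (hH : 0 < H) (hH' : H < 3 / 4) :
    ∃ γ K : ℝ, (γ = 2 - 2 * H ∨ (2 * H = 1 ∧ γ = 2)) ∧ 1 / 2 < γ ∧ 0 < K ∧ ∀ n : ℕ, 1 ≤ n →
      (∑ k ∈ Finset.range n, ((k : ℝ) + 1) ^ (-γ)) ^ 2 ≤ K * (n * rate H n) ∧
      ∑ k ∈ Finset.range n, ((k : ℝ) + 1) ^ (1 - 2 * γ) ≤ K * (n * rate H n) := by
  -- For H ≤ 1/2, γ > 1: both sums are bounded and n ψ_H(n) = 1. For H > 1/2 both sums are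
  -- O(n^{2-2γ}), and n^{2-2γ} = n^{4H-2} = n ψ_H(n). The condition H < 3/4 is γ > 1/2, that is,
  -- square summability.
  rcases le_or_gt H (1 / 2) with h | h
  · obtain ⟨γ, hγ, hγ1⟩ : ∃ γ : ℝ, (γ = 2 - 2 * H ∨ (2 * H = 1 ∧ γ = 2)) ∧ 1 < γ := by
      rcases h.lt_or_eq with h | h
      · exact ⟨2 - 2 * H, Or.inl rfl, by linarith⟩
      · exact ⟨2, Or.inr ⟨by linarith, rfl⟩, by norm_num⟩
    have hs : 1 < 2 * γ - 1 := by linarith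
    have hγ0 : 0 < γ - 1 := by linarith
    have hs0 : 0 < 2 * γ - 1 - 1 := by linarith
    refine ⟨γ, (1 + 1 / (γ - 1)) ^ 2 + (1 + 1 / (2 * γ - 1 - 1)), hγ, by linarith, by positivity,
      fun n hn => ?_⟩
    have hn0 : (n : ℝ) ≠ 0 := by positivity
    have hr : n * rate H n = 1 := by
      rw [rate]
      split_ifs with h'
      · exact mul_inv_cancel₀ hn0
      · have : H = 1 / 2 := le_antisymm h (not_lt.1 h')
        rw [this, show (4 * (1 / 2) - 3 : ℝ) = -1 by norm_num, Real.rpow_neg_one]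
        exact mul_inv_cancel₀ hn0
    rw [hr, mul_one]
    have h1 := pow_le_pow_left₀ (Finset.sum_nonneg fun k _ => by positivity)
      (sum_rpow_neg_le_const hγ1 n) 2
    have h2 := sum_rpow_neg_le_const hs n
    rw [neg_sub] at h2
    have h3 : 0 ≤ 1 + 1 / (2 * γ - 1 - 1) := by positivity
    have h4 : 0 ≤ (1 + 1 / (γ - 1)) ^ 2 := by positivity
    exact ⟨by linarith, by linarith⟩
  · set γ := 2 - 2 * H with hγ
    have hγ1 : 0 < 1 - γ := by linarith
    refine ⟨γ, (1 / (1 - γ)) ^ 2 + 1 / (1 - (2 * γ - 1)), Or.inl rfl, by linarith, ?_,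
      fun n hn => ?_⟩
    · have : 0 < 1 - (2 * γ - 1) := by linarith
      positivity
    have hn0 : (0 : ℝ) < n := by positivity
    have hr : n * rate H n = (n : ℝ) ^ (2 - 2 * γ) := by
      rw [rate, if_neg (by linarith), mul_comm, ← Real.rpow_add_one hn0.ne', hγ]
      ring_nf
    rw [hr]
    have h1 := pow_le_pow_left₀ (Finset.sum_nonneg fun k _ => by positivity)
      (sum_rpow_neg_le (s := γ) (by linarith) (by linarith) n) 2
    have h2 := sum_rpow_neg_le (s := 2 * γ - 1) (by linarith) (by linarith) n
    rw [neg_sub, show 1 - (2 * γ - 1) = 2 - 2 * γ by ring] at h2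
    have e1 : ((n : ℝ) ^ (1 - γ) / (1 - γ)) ^ 2 = (1 / (1 - γ)) ^ 2 * (n : ℝ) ^ (2 - 2 * γ) := by
      rw [div_pow, ← Real.rpow_natCast ((n : ℝ) ^ (1 - γ)), ← Real.rpow_mul hn0.le]
      push_cast
      rw [show (1 - γ) * 2 = 2 - 2 * γ by ring]
      field_simp
    have h3 : 0 ≤ (n : ℝ) ^ (2 - 2 * γ) := by positivity
    have h4 : 0 ≤ (1 / (1 - γ)) ^ 2 * (n : ℝ) ^ (2 - 2 * γ) := by positivity
    have h5 : 0 ≤ (n : ℝ) ^ (2 - 2 * γ) / (2 - 2 * γ) := div_nonneg h3 (by linarith)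
    rw [e1] at h1
    rw [show 1 - (2 * γ - 1) = 2 - 2 * γ by ring, add_mul, one_div_mul_eq_div]
    exact ⟨by linarith, by linarith⟩

lemma tendsto_rate (hH' : H < 3 / 4) : Tendsto (rate H) atTop (𝓝 0) := by
  by_cases h : H < 1 / 2
  · have : rate H = fun n : ℕ => (n : ℝ)⁻¹ := funext fun n => by rw [rate, if_pos h]
    rw [this]
    exact tendsto_inv_atTop_nhds_zero_nat
  · have : rate H = fun n : ℕ => (n : ℝ) ^ (-(3 - 4 * H)) := funext fun n => by
      rw [rate, if_neg h, neg_sub]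
    rw [this]
    exact (tendsto_rpow_neg_atTop (by linarith)).comp tendsto_natCast_atTop_atTop

/-- The asymptotic variance in terms of the stationary covariance. -/
noncomputable def limitVariance (θ H : ℝ) : ℝ :=
  2 * statCov θ (2 * H) 0 ^ 2 + 4 * ∑' k : ℕ, statCov θ (2 * H) ((k : ℝ) + 1) ^ 2

lemma statCov_sq_le {γ K : ℝ} {α : ℝ}
    (hK : ∀ k : ℕ, |statCov θ α k| ≤ K * ((k : ℝ) + 1) ^ (-γ)) (k : ℕ) :
    statCov θ α k ^ 2 ≤ K ^ 2 * ((k : ℝ) + 1) ^ (-(2 * γ)) := by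
  have h := pow_le_pow_left₀ (abs_nonneg _) (hK k) 2
  rw [sq_abs, mul_pow, ← Real.rpow_natCast (((k : ℝ) + 1) ^ (-γ)),
    ← Real.rpow_mul (by positivity)] at h
  push_cast at h
  rwa [show -γ * 2 = -(2 * γ) by ring] at h

lemma exists_rate_bound (hθ : 0 < θ) (hH : 0 < H) (hH' : H < 3 / 4) :
    Summable (fun k : ℕ => statCov θ (2 * H) ((k : ℝ) + 1) ^ 2) ∧
    ∃ C : ℝ, 0 < C ∧ ∀ n : ℕ, 1 ≤ n →
      |2 / n * ∑ i ∈ Finset.range n, ∑ j ∈ Finset.range n,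
          ouCov θ (2 * H) ((i : ℝ) + 1) ((j : ℝ) + 1) ^ 2 - limitVariance θ H| ≤
        C * rate H n := by
  obtain ⟨γ, K, hγ, hγ1, hK, hrate⟩ := exists_exponent hH hH'
  obtain ⟨K₁, hK₁, h₁⟩ := exists_sum_sum_abs_sub_le hθ (α := 2 * H) (by linarith) (by linarith) hγ
  obtain ⟨K₂, hK₂, h₂, -⟩ := exists_decay hθ (α := 2 * H) (by linarith) (by linarith) hγ
  have h₃ (n : ℕ) := abs_sum_sum_sub_le (F := fun x => statCov θ (2 * H) x ^ 2)
    (fun x => by simp only [statCov_neg hθ]) (fun x => sq_nonneg _) (s := 2 * γ) (by linarith)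
    (statCov_sq_le h₂) n
  refine ⟨(h₃ 0).1, 2 * (K₁ * K + 2 * (K₂ ^ 2 / (2 * γ - 1)) * K), ?_, fun n hn => ?_⟩
  · have : 0 < 2 * γ - 1 := by linarith
    positivity
  have hn0 : (0 : ℝ) < n := by positivity
  obtain ⟨r₁, r₂⟩ := hrate n hn
  have t1 := (h₁ n).trans (mul_le_mul_of_nonneg_left r₁ hK₁.le)
  have t2 := (h₃ n).2.trans (mul_le_mul_of_nonneg_left r₂
    (by have : 0 < 2 * γ - 1 := by linarith
        positivity))
  set A := ∑ i ∈ Finset.range n, ∑ j ∈ Finset.range n,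
    ouCov θ (2 * H) ((i : ℝ) + 1) ((j : ℝ) + 1) ^ 2
  set B := ∑ i ∈ Finset.range n, ∑ j ∈ Finset.range n, statCov θ (2 * H) ((j : ℝ) - i) ^ 2
  set D := statCov θ (2 * H) 0 ^ 2 + 2 * ∑' k : ℕ, statCov θ (2 * H) ((k : ℝ) + 1) ^ 2
  -- A - B is the effect of non-stationarity, B - nD the effect of truncating the stationary series.
  have e : 2 / n * A - limitVariance θ H = 2 / n * ((A - B) + (B - n * D)) := by
    rw [limitVariance]
    simp only [D]
    field_simp
    ring
  rw [e, abs_mul, abs_of_pos (by positivity), div_mul_eq_mul_div, div_le_iff₀ hn0]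
  have t3 := abs_add_le (A - B) (B - n * D)
  nlinarith

lemma limitVariance_pos (hθ : 0 < θ) (hH : 0 < H) (hH' : H < 3 / 4) : 0 < limitVariance θ H := by
  have h1 : 0 < statCov θ (2 * H) 0 := by
    rw [statCov_zero hθ (by linarith) (by linarith)]
    have := Real.Gamma_pos_of_pos (show 0 < 2 * H + 1 by linarith)
    positivity
  have h2 : 0 ≤ ∑' k : ℕ, statCov θ (2 * H) ((k : ℝ) + 1) ^ 2 :=
    tsum_nonneg fun k => sq_nonneg _
  rw [limitVariance]
  positivity

/-- The nonzero integers split into k + 1 and -(k + 1), which contribute equally by evenness. -/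
lemma hasSum_nonzero_int {F : ℝ → ℝ} (hF : ∀ x, F (-x) = F x)
    (hs : Summable fun k : ℕ => F ((k : ℝ) + 1)) :
    HasSum (fun i : {i : ℤ // i ≠ 0} => F (i : ℤ)) (2 * ∑' k : ℕ, F ((k : ℝ) + 1)) := by
  have h : HasSum ({i : ℤ | i ≠ 0}.indicator fun i : ℤ => F i)
      (∑' k : ℕ, F ((k : ℝ) + 1) + ∑' k : ℕ, F ((k : ℝ) + 1)) := by
    refine HasSum.of_nat_of_neg_add_one ?_ ?_
    · rw [← hasSum_nat_add_iff' 1]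
      simpa [Set.indicator_apply, Nat.cast_add_one_ne_zero] using! hs.hasSum
    · have hk (k : ℕ) : -((k : ℤ) + 1) ≠ 0 := by omega
      have he : (fun k : ℕ => ({i : ℤ | i ≠ 0}.indicator fun i : ℤ => F i) (-((k : ℤ) + 1))) =
          fun k : ℕ => F ((k : ℝ) + 1) := by
        ext k
        rw [Set.indicator_of_mem (by simpa using hk k)]
        push_cast
        rw [hF]
      rw [he]
      exact hs.hasSum
  rw [two_mul]
  exact hasSum_subtype_iff_indicator.2 h

end Rates

/-! ### The critical index 3/4 -/

section Critical

variable {θ : ℝ}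

lemma sum_partialHarmonic (n : ℕ) :
    ∑ m ∈ Finset.range n, ∑ k ∈ Finset.range m, ((k : ℝ) + 1)⁻¹ =
      n * ∑ k ∈ Finset.range n, ((k : ℝ) + 1)⁻¹ - n := by
  induction n with
  | zero => simp
  | succ n ih =>
    rw [Finset.sum_range_succ, ih, Finset.sum_range_succ]
    have : (n : ℝ) + 1 ≠ 0 := by positivity
    push_cast
    field_simp
    ring

lemma abs_partialHarmonic_sub_log_le {n : ℕ} (hn : 1 ≤ n) :
    |∑ k ∈ Finset.range n, ((k : ℝ) + 1)⁻¹ - Real.log n| ≤ 1 := by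
  have e : ((harmonic n : ℚ) : ℝ) = ∑ k ∈ Finset.range n, ((k : ℝ) + 1)⁻¹ := by
    simp [harmonic]
  have h1 := harmonic_le_one_add_log n
  have h2 := log_add_one_le_harmonic n
  rw [e] at h1 h2
  have hn0 : (0 : ℝ) < n := by positivity
  have h3 : Real.log n ≤ Real.log ((n + 1 : ℕ) : ℝ) :=
    Real.log_le_log hn0 (by push_cast; linarith)
  rw [abs_le]
  constructor <;> linarith

/-- Here γ = 1/2, so the deviation adds O((∑ k^{-1/2})²) = O(n), and the stationary double sum is
2c² times a sum of harmonic numbers, up to O(n). Since c = 3/(8θ²), the factor 2/n turns this into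
4c² log n + O(1). -/
lemma exists_log_bound (hθ : 0 < θ) :
    ∃ C : ℝ, 0 < C ∧ ∀ n : ℕ, 1 ≤ n →
      |2 / n * ∑ i ∈ Finset.range n, ∑ j ∈ Finset.range n,
          ouCov θ (3 / 2) ((i : ℝ) + 1) ((j : ℝ) + 1) ^ 2 - 9 / (16 * θ ^ 4) * Real.log n| ≤ C := by
  obtain ⟨K₁, hK₁, h₁⟩ := exists_sum_sum_abs_sub_le hθ (α := 3 / 2) (γ := 1 / 2) (by norm_num)
    (by norm_num) (Or.inl (by norm_num))
  obtain ⟨C, hC, hρ⟩ := exists_abs_statCov_sub_le hθ (α := 3 / 2) (by norm_num) (by norm_num)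
  set c : ℝ := 3 / 2 * (3 / 2 - 1) / (2 * θ ^ 2) with hc
  have hc0 : 0 < c := by rw [hc]; norm_num; positivity
  set f : ℝ → ℝ := fun x => statCov θ (3 / 2) x ^ 2 with hf
  -- Squaring c w^{-1/2} + r with |r| ≤ C w^{-3/2} leaves a summable error of order w^{-2}.
  have hfb (k : ℕ) : |f ((k : ℝ) + 1) - c ^ 2 * ((k : ℝ) + 1)⁻¹| ≤
      C * (2 * c + C) * ((k : ℝ) + 1) ^ (-(2 : ℝ)) := by
    have hw : (1 : ℝ) ≤ (k : ℝ) + 1 := by linarith [(Nat.cast_nonneg k : (0 : ℝ) ≤ k)]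
    set w := (k : ℝ) + 1
    have hw0 : 0 < w := by linarith
    have h := hρ w hw0
    set r := statCov θ (3 / 2) w - c * w ^ ((3 : ℝ) / 2 - 2) with hr
    have e1 : (w ^ ((3 : ℝ) / 2 - 2)) ^ 2 = w⁻¹ := by
      rw [← Real.rpow_natCast, ← Real.rpow_mul hw0.le, ← Real.rpow_neg_one]
      norm_num
    have e2 : w ^ ((3 : ℝ) / 2 - 3) * w ^ ((3 : ℝ) / 2 - 2) = w ^ (-(2 : ℝ)) := by
      rw [← Real.rpow_add hw0]
      norm_num
    have h3 : w ^ ((3 : ℝ) / 2 - 3) ≤ w ^ ((3 : ℝ) / 2 - 2) :=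
      Real.rpow_le_rpow_of_exponent_le hw (by norm_num)
    have hp : 0 < w ^ ((3 : ℝ) / 2 - 2) := by positivity
    have e3 : f w - c ^ 2 * w⁻¹ = r * (2 * c * w ^ ((3 : ℝ) / 2 - 2) + r) := by
      simp only [hf]
      rw [← e1, hr]
      ring
    have h4 : |2 * c * w ^ ((3 : ℝ) / 2 - 2) + r| ≤ (2 * c + C) * w ^ ((3 : ℝ) / 2 - 2) := by
      refine (abs_add_le _ _).trans ?_
      rw [abs_of_pos (show 0 < 2 * c * w ^ ((3 : ℝ) / 2 - 2) by positivity)]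
      nlinarith
    rw [e3, abs_mul, ← e2]
    calc _ ≤ (C * w ^ ((3 : ℝ) / 2 - 3)) * ((2 * c + C) * w ^ ((3 : ℝ) / 2 - 2)) :=
          mul_le_mul h h4 (abs_nonneg _) (by positivity)
      _ = _ := by ring
  set K := C * (2 * c + C) * 2 with hK
  have hK0 : 0 < K := by positivity
  have hpart (m : ℕ) : |∑ k ∈ Finset.range m, f ((k : ℝ) + 1) -
      c ^ 2 * ∑ k ∈ Finset.range m, ((k : ℝ) + 1)⁻¹| ≤ K := by
    rw [Finset.mul_sum, ← Finset.sum_sub_distrib]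
    refine (Finset.abs_sum_le_sum_abs _ _).trans
      ((Finset.sum_le_sum fun k _ => hfb k).trans ?_)
    rw [← Finset.mul_sum, hK]
    have := sum_rpow_neg_le_const (s := 2) (by norm_num) m
    rw [show (1 : ℝ) + 1 / (2 - 1) = 2 by norm_num] at this
    exact mul_le_mul_of_nonneg_left this (by positivity)
  refine ⟨2 * (4 * K₁ + |f 0| + 2 * K + 4 * c ^ 2), by positivity, fun n hn => ?_⟩
  have hn0 : (0 : ℝ) < n := by positivity
  have hA : (∑ k ∈ Finset.range n, ((k : ℝ) + 1) ^ (-(1 / 2) : ℝ)) ^ 2 ≤ 4 * n := by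
    have h := pow_le_pow_left₀ (Finset.sum_nonneg fun k _ => by positivity)
      (sum_rpow_neg_le (s := 1 / 2) (by norm_num) (by norm_num) n) 2
    refine h.trans (le_of_eq ?_)
    rw [show (1 : ℝ) - 1 / 2 = 1 / 2 by norm_num, ← Real.sqrt_eq_rpow, div_pow,
      Real.sq_sqrt hn0.le]
    ring
  have t1 := (h₁ n).trans (mul_le_mul_of_nonneg_left hA hK₁.le)
  set A := ∑ i ∈ Finset.range n, ∑ j ∈ Finset.range n,
    ouCov θ (3 / 2) ((i : ℝ) + 1) ((j : ℝ) + 1) ^ 2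
  have hS := sum_sum_sub_eq (F := f) (fun x => by simp only [hf, statCov_neg hθ]) n
  simp only [hf] at hS t1
  rw [hS] at t1
  set P := ∑ m ∈ Finset.range n, ∑ k ∈ Finset.range m, statCov θ (3 / 2) ((k : ℝ) + 1) ^ 2
  set h := ∑ k ∈ Finset.range n, ((k : ℝ) + 1)⁻¹ with hh
  have t2 : |P - c ^ 2 * (n * h - n)| ≤ n * K := by
    rw [hh, ← sum_partialHarmonic, Finset.mul_sum, ← Finset.sum_sub_distrib]
    refine (Finset.abs_sum_le_sum_abs _ _).trans
      ((Finset.sum_le_sum fun m _ => hpart m).trans (le_of_eq ?_))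
    simp
  have t3 := abs_partialHarmonic_sub_log_le hn
  have hcc : 9 / (16 * θ ^ 4) = 4 * c ^ 2 := by
    rw [hc]
    field_simp
    norm_num
  have e : 2 / n * A - 9 / (16 * θ ^ 4) * Real.log n =
      2 / n * ((A - (n * f 0 + 2 * P)) + n * f 0 + 2 * (P - c ^ 2 * (n * h - n)) +
        n * (2 * c ^ 2 * (h - Real.log n) - 2 * c ^ 2)) := by
    rw [hcc]
    field_simp
    ring
  rw [e, abs_mul, abs_of_pos (by positivity), div_mul_eq_mul_div, div_le_iff₀ hn0]
  have s1 := abs_le.1 t1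
  have s2 := abs_le.1 t2
  have s3 := abs_le.1 t3
  have s4 := mul_le_mul_of_nonneg_left (le_abs_self (f 0)) hn0.le
  have s5 := mul_le_mul_of_nonneg_left (neg_abs_le (f 0)) hn0.le
  have hnc : 0 < n * c ^ 2 := by positivity
  have s6 := mul_le_mul_of_nonneg_left s3.1 hnc.le
  have s7 := mul_le_mul_of_nonneg_left s3.2 hnc.le
  have key : |(A - (n * f 0 + 2 * P)) + n * f 0 + 2 * (P - c ^ 2 * (n * h - n)) +
        n * (2 * c ^ 2 * (h - Real.log n) - 2 * c ^ 2)| ≤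
        (4 * K₁ + |f 0| + 2 * K + 4 * c ^ 2) * n := by
    simp only [hf] at s1 s4 s5 ⊢
    rw [abs_le]
    constructor <;> nlinarith
  linarith

end Critical

/-! ### From the processes to deterministic covariance sums -/

section Variance

variable {Ω : Type*} [MeasurableSpace Ω] {μ : Measure Ω}

lemma IsCenteredGaussian.memLp_sq {Y : Ω → ℝ} (h : IsCenteredGaussian Y μ) :
    MemLp (fun ω => Y ω ^ 2) 2 μ := by
  rw [memLp_two_iff_integrable_sq (h.law.aemeasurable.pow_const 2).aestronglyMeasurable]
  refine (h.integrable_pow 4).congr (Eventually.of_forall fun ω => ?_)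
  ring

lemma IsGaussianSpace.memLp_quadVar [IsProbabilityMeasure μ] {M : Submodule ℝ (Ω → ℝ)}
    (hM : IsGaussianSpace M μ) {X : ℝ≥0 → Ω → ℝ} (hX : ∀ t, X t ∈ M) (n : ℕ) :
    MemLp (quadVar X μ n) 2 μ := by
  have h := memLp_finsetSum (μ := μ) (p := 2) (Finset.Icc 1 n)
    (f := fun (i : ℕ) ω => X (i : ℝ≥0) ω ^ 2 - ∫ ω', X (i : ℝ≥0) ω' ^ 2 ∂μ)
    fun i _ => (hM _ (hX i)).memLp_sq.sub (memLp_const _)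
  exact h.const_mul (1 / √(n : ℝ))

lemma IsGaussianSpace.quadVarVariance_eq [IsProbabilityMeasure μ] {M : Submodule ℝ (Ω → ℝ)}
    (hM : IsGaussianSpace M μ) {X : ℝ≥0 → Ω → ℝ} (hX : ∀ t, X t ∈ M) (n : ℕ) :
    quadVarVariance X μ n = 2 / n * ∑ i ∈ Finset.Icc 1 n, ∑ j ∈ Finset.Icc 1 n,
      (∫ ω, X (i : ℝ≥0) ω * X (j : ℝ≥0) ω ∂μ) ^ 2 := by
  set D : ℕ → Ω → ℝ := fun i ω => X (i : ℝ≥0) ω ^ 2 - ∫ ω', X (i : ℝ≥0) ω' ^ 2 ∂μ with hD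
  have hsq (ω : Ω) : quadVar X μ n ω ^ 2 =
      1 / n * ∑ i ∈ Finset.Icc 1 n, ∑ j ∈ Finset.Icc 1 n, D i ω * D j ω := by
    rw [quadVar, mul_pow, div_pow, one_pow, Real.sq_sqrt (Nat.cast_nonneg n), sq,
      Finset.sum_mul_sum]
  have hDm (i : ℕ) : MemLp (D i) 2 μ := (hM _ (hX i)).memLp_sq.sub (memLp_const _)
  have hDD (i j : ℕ) : Integrable (fun ω => D i ω * D j ω) μ := (hDm i).integrable_mul (hDm j)
  -- Centering removes the product of variances from Isserlis' formula.
  have hval (i j : ℕ) : ∫ ω, D i ω * D j ω ∂μ =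
      2 * (∫ ω, X (i : ℝ≥0) ω * X (j : ℝ≥0) ω ∂μ) ^ 2 := by
    obtain ⟨h1, h2⟩ := hM.integral_sq_mul_sq (hX i) (hX j)
    have i1 := (hM _ (hX i)).integrable_pow 2
    have i2 := (hM _ (hX j)).integrable_pow 2
    set a := ∫ ω, X (i : ℝ≥0) ω ^ 2 ∂μ with ha
    set b := ∫ ω, X (j : ℝ≥0) ω ^ 2 ∂μ with hb
    have e : (fun ω => D i ω * D j ω) = fun ω => X (i : ℝ≥0) ω ^ 2 * X (j : ℝ≥0) ω ^ 2 -
        (b * X (i : ℝ≥0) ω ^ 2 + a * X (j : ℝ≥0) ω ^ 2 - a * b) := by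
      ext ω
      simp only [hD, ← ha, ← hb]
      ring
    have k1 := i1.const_mul b
    have k2 := i2.const_mul a
    rw [e, integral_sub h1 (by exact (k1.add k2).sub (integrable_const _)),
      integral_sub (by exact k1.add k2) (integrable_const _), integral_add k1 k2,
      integral_const_mul, integral_const_mul, integral_const, h2, ← ha, ← hb]
    simp
    ring
  rw [quadVarVariance]
  simp only [hsq]
  rw [integral_const_mul, integral_finsetSum _ fun i _ => integrable_finsetSum _ fun j _ =>
    hDD i j, Finset.sum_congr rfl fun i _ => integral_finsetSum _ fun j _ => hDD i j]
  simp only [hval, ← Finset.mul_sum]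
  ring

lemma IsOUSolution.covariance_eq [IsProbabilityMeasure μ] {S X : ℝ≥0 → Ω → ℝ} {θ H : ℝ}
    (hθ : 0 < θ) (hH : 0 < H) (hH1 : H ≤ 1) (hS : IsSubFracBM H S μ) (hX : IsOUSolution θ S X μ)
    (s t : ℝ≥0) : ∫ ω, X s ω * X t ω ∂μ = ouCov θ (2 * H) s t := by
  have hcont : Continuous fun u : ℝ => |u| ^ (2 * H) :=
    continuous_abs.rpow_const fun _ => Or.inr (by positivity)
  have h := ouFunctional_ouFunctional hθ (α := 2 * H) (by positivity) (by linarith) s.2 t.2 1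
    (fun v => |v| ^ (2 * H)) hcont
  rw [(hX.gaussian hθ hS).2 s t]
  -- On nonnegative times the kernel agrees with its extension through absolute values, to which the
  -- general formula applies with ε = 1 and T = 0.
  refine Eq.trans (ouFunctional_congr t.2 fun v hv => ouFunctional_congr s.2 fun u hu => ?_)
    (h.trans ?_)
  · rw [subFracCov, Real.coe_toNNReal u hu.1, Real.coe_toNNReal v hv.1, abs_of_nonneg hu.1,
      abs_of_nonneg hv.1, abs_of_nonneg (add_nonneg hu.1 hv.1), abs_sub_comm u v,
      add_comm u v]
    ring
  · rw [ouCov, covDeviation]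
    simp only [NNReal.val_eq_coe, sub_zero, add_zero, one_mul]
    ring

lemma exists_abs_statCov_le {θ α : ℝ} (hθ : 0 < θ) (hα : 0 < α) (hα2 : α ≤ 2) :
    ∃ K : ℝ, ∀ w : ℝ, 1 ≤ w → |statCov θ α w| ≤ K := by
  obtain ⟨C, hC, h⟩ := exists_abs_statCov_sub_le hθ hα hα2
  refine ⟨C + |α * (α - 1) / (2 * θ ^ 2)|, fun w hw => ?_⟩
  have h1 := h w (by linarith)
  have h2 : w ^ (α - 2) ≤ 1 := Real.rpow_le_one_of_one_le_of_nonpos hw (by linarith)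
  have h3 : w ^ (α - 3) ≤ 1 := Real.rpow_le_one_of_one_le_of_nonpos hw (by linarith)
  have h4 := abs_sub_abs_le_abs_sub (statCov θ α w) (α * (α - 1) / (2 * θ ^ 2) * w ^ (α - 2))
  rw [abs_mul, abs_of_pos (Real.rpow_pos_of_pos (show 0 < w by linarith) (α - 2))] at h4
  have h5 := abs_nonneg (α * (α - 1) / (2 * θ ^ 2))
  nlinarith

lemma IsStationaryOU.covariance_eq [IsProbabilityMeasure μ] {B Z : ℝ → Ω → ℝ} {θ H : ℝ}
    (hθ : 0 < θ) (hH : 0 < H) (hH1 : H ≤ 1) (hB : IsFracBM H B μ) (hZ : IsStationaryOU θ B Z μ)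
    (s t : ℝ) : ∫ ω, Z s ω * Z t ω ∂μ = statCov θ (2 * H) (t - s) := by
  -- The extra 1 keeps s - T and t - T at least 1, the range where `statCov` is known to be bounded.
  obtain ⟨T₀, hT₀⟩ := exists_nat_ge (max (-s) (-t) + 1)
  have hs : -(T₀ : ℝ) + 1 ≤ s := by linarith [le_max_left (-s) (-t)]
  have ht : -(T₀ : ℝ) + 1 ≤ t := by linarith [le_max_right (-s) (-t)]
  refine tendsto_nhds_unique
    ((hZ.gaussian hθ hB).2 s t T₀ (by linarith) (by linarith)) ?_
  obtain ⟨K, hK⟩ := exists_abs_statCov_le hθ (α := 2 * H) (by positivity) (by linarith)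
  have hcont : Continuous fun u : ℝ => 1 / 2 * |u| ^ (2 * H) :=
    continuous_const.mul (continuous_abs.rpow_const fun _ => Or.inr (by positivity))
  set T : ℕ → ℝ := fun m => -((m + T₀ : ℕ) : ℝ) with hT
  have hTle (r : ℝ) (hr : -(T₀ : ℝ) + 1 ≤ r) (m : ℕ) : 1 ≤ r - T m := by
    simp only [hT]
    push_cast
    linarith [(Nat.cast_nonneg m : (0 : ℝ) ≤ m)]
  have hform (m : ℕ) : (ouFunctional θ (T m) t fun v => ouFunctional θ (T m) s fun u =>
      fracCov H u v) = statCov θ (2 * H) (t - s) -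
        Real.exp (-θ * (t - T m)) * statCov θ (2 * H) (s - T m) -
        Real.exp (-θ * (s - T m)) * statCov θ (2 * H) (t - T m) +
        Real.exp (-θ * (s - T m)) * Real.exp (-θ * (t - T m)) * statCov θ (2 * H) 0 := by
    have h1 := hTle s hs m
    have h2 := hTle t ht m
    have h := ouFunctional_ouFunctional hθ (α := 2 * H) (by positivity) (by linarith)
      (show T m ≤ s by linarith) (show T m ≤ t by linarith) 0
      (fun v => 1 / 2 * |v| ^ (2 * H)) hcont
    refine Eq.trans ?_ (h.trans (by ring))
    congr with v
    congr with u
    rw [fracCov, abs_sub_comm v u]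
    ring
  have hexp (r : ℝ) : Tendsto (fun m => Real.exp (-θ * (r - T m))) atTop (𝓝 0) := by
    refine Real.tendsto_exp_atBot.comp ?_
    have h1 : Tendsto (fun m : ℕ => r - T m) atTop atTop := by
      simp only [hT, sub_neg_eq_add]
      exact tendsto_atTop_add_const_left _ _
        (tendsto_natCast_atTop_atTop.comp (tendsto_add_atTop_nat T₀))
    exact h1.const_mul_atTop_of_neg (by linarith)
  have hprod (a b : ℝ) (hb : -(T₀ : ℝ) + 1 ≤ b) :
      Tendsto (fun m => Real.exp (-θ * (a - T m)) * statCov θ (2 * H) (b - T m)) atTop (𝓝 0) :=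
    (hexp a).zero_mul_isBoundedUnder_le
      (isBoundedUnder_of ⟨K, fun m => hK _ (hTle b hb m)⟩)
  -- Every boundary term carries an exponential factor tending to 0 as T → -∞, against bounded
  -- values of `statCov`.
  have hlim := (((tendsto_const_nhds (x := statCov θ (2 * H) (t - s))).sub (hprod t s hs)).sub
    (hprod s t ht)).add (((hexp s).mul (hexp t)).mul_const (statCov θ (2 * H) 0))
  simp only [sub_zero, mul_zero, zero_mul, add_zero] at hlim
  exact hlim.congr fun m => (hform m).symm

lemma IsOUSolution.quadVarVariance_eq [IsProbabilityMeasure μ] {S X : ℝ≥0 → Ω → ℝ} {θ H : ℝ}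
    (hθ : 0 < θ) (hH : 0 < H) (hH1 : H ≤ 1) (hS : IsSubFracBM H S μ) (hX : IsOUSolution θ S X μ)
    (n : ℕ) : quadVarVariance X μ n = 2 / n * ∑ i ∈ Finset.range n, ∑ j ∈ Finset.range n,
      ouCov θ (2 * H) ((i : ℝ) + 1) ((j : ℝ) + 1) ^ 2 := by
  obtain ⟨M, hM, hXM⟩ := (hX.gaussian hθ hS).1
  rw [hM.quadVarVariance_eq hXM]
  simp only [sum_Icc_one_eq_sum_range, hX.covariance_eq hθ hH hH1 hS]
  push_cast
  rfl

end Variance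

lemma asympVar_eq {θ H : ℝ} (hθ : 0 < θ) (hH : 0 < H) (hH' : H < 3 / 4) {ρ : ℤ → ℝ}
    (hρ : ∀ k : ℤ, ρ k = statCov θ (2 * H) k) :
    Summable (fun i : {i : ℤ // i ≠ 0} => ρ i ^ 2) ∧ asympVar ρ = limitVariance θ H := by
  have h := hasSum_nonzero_int (F := fun x => statCov θ (2 * H) x ^ 2)
    (fun x => by simp only [statCov_neg hθ]) (exists_rate_bound hθ hH hH').1
  simp only [← hρ] at h
  refine ⟨h.summable, ?_⟩
  rw [asympVar, h.tsum_eq, hρ, limitVariance]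
  push_cast
  ring

lemma tendsto_of_abs_sub_le_rate {v : ℕ → ℝ} {L C H : ℝ} (hH' : H < 3 / 4)
    (h : ∀ n : ℕ, 1 ≤ n → |v n - L| ≤ C * rate H n) : Tendsto v atTop (𝓝 L) := by
  rw [tendsto_iff_norm_sub_tendsto_zero]
  have h1 : Tendsto (fun n => C * rate H n) atTop (𝓝 0) := by
    simpa using (tendsto_rate hH').const_mul C
  refine squeeze_zero' (Eventually.of_forall fun n => norm_nonneg _) ?_ h1
  filter_upwards [eventually_ge_atTop 1] with n hn using h n hn

end SubFracOU

/-! ### Conclusion -/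

theorem mainTheorem8 (θ H : ℝ) (hθ : 0 < θ) :
    (0 < H → H < 3 / 4 →
      ∃ C : ℝ, 0 < C ∧
        ∀ (Ω : Type u) [MeasurableSpace Ω] (μ : Measure Ω) [IsProbabilityMeasure μ]
          (S X : ℝ≥0 → Ω → ℝ),
          SubFracOU.IsSubFracBM H S μ → SubFracOU.IsOUSolution θ S X μ →
          (∀ t, MemLp (X t) 2 μ) ∧
          (∀ n, MemLp (SubFracOU.quadVar X μ n) 2 μ) ∧
          SubFracOU.HypothesisH2 X μ ∧
          ∀ (Ω' : Type v) [MeasurableSpace Ω'] (ν : Measure Ω') [IsProbabilityMeasure ν]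
            (B Z : ℝ → Ω' → ℝ),
            SubFracOU.IsFracBM H B ν → SubFracOU.IsStationaryOU θ B Z ν →
            (∀ t, MemLp (Z t) 2 ν) ∧
            SubFracOU.autoCov Z ν 0 = SubFracOU.limitVar H θ ∧
            Summable (fun i : {i : ℤ // i ≠ 0} => SubFracOU.autoCov Z ν i ^ 2) ∧
            0 < SubFracOU.asympVar (SubFracOU.autoCov Z ν) ∧
            (∀ n : ℕ, 1 ≤ n →
              |SubFracOU.quadVarVariance X μ n
                  - SubFracOU.asympVar (SubFracOU.autoCov Z ν)| ≤ C * SubFracOU.rate H n) ∧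
            Tendsto (SubFracOU.quadVarVariance X μ) atTop
              (𝓝 (SubFracOU.asympVar (SubFracOU.autoCov Z ν)))) ∧
    (H = 3 / 4 →
      ∃ C : ℝ, 0 < C ∧
        ∀ (Ω : Type u) [MeasurableSpace Ω] (μ : Measure Ω) [IsProbabilityMeasure μ]
          (S X : ℝ≥0 → Ω → ℝ),
          SubFracOU.IsSubFracBM H S μ → SubFracOU.IsOUSolution θ S X μ →
          (∀ t, MemLp (X t) 2 μ) ∧
          (∀ n, MemLp (SubFracOU.quadVar X μ n) 2 μ) ∧
          (∀ n : ℕ, 2 ≤ n →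
            |SubFracOU.quadVarVariance X μ n / Real.log n - 9 / (16 * θ ^ 4)|
              ≤ C * (Real.log n)⁻¹) ∧
          Tendsto (fun n : ℕ => SubFracOU.quadVarVariance X μ n / Real.log n) atTop
            (𝓝 (9 / (16 * θ ^ 4)))) := by
  refine ⟨fun hH hH' => ?_, ?_⟩
  · obtain ⟨-, C, hC, hbound⟩ := SubFracOU.exists_rate_bound hθ hH hH'
    -- The constant comes from a deterministic estimate and so precedes the choice of probability
    -- space and processes.
    refine ⟨C, hC, fun Ω _ μ _ S X hS hX => ?_⟩
    obtain ⟨M, hM, hXM⟩ := (hX.gaussian hθ hS).1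
    have hb (n : ℕ) (hn : 1 ≤ n) : |SubFracOU.quadVarVariance X μ n -
        SubFracOU.limitVariance θ H| ≤ C * SubFracOU.rate H n := by
      rw [hX.quadVarVariance_eq hθ hH (by linarith) hS]
      exact hbound n hn
    have hlim := SubFracOU.tendsto_of_abs_sub_le_rate hH' hb
    have hpos := SubFracOU.limitVariance_pos hθ hH hH'
    refine ⟨fun t => (hM _ (hXM t)).memLp (by simp), hM.memLp_quadVar hXM,
      ⟨_, hpos, hlim⟩, fun Ω' _ ν _ B Z hB hZ => ?_⟩
    obtain ⟨M', hM', hZM⟩ := (hZ.gaussian hθ hB).1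
    have hρ (k : ℤ) : SubFracOU.autoCov Z ν k = SubFracOU.statCov θ (2 * H) k := by
      rw [SubFracOU.autoCov, hZ.covariance_eq hθ hH (by linarith) hB, zero_sub,
        SubFracOU.statCov_neg hθ]
    obtain ⟨hsum, hvar⟩ := SubFracOU.asympVar_eq hθ hH hH' hρ
    rw [hvar]
    refine ⟨fun t => (hM' _ (hZM t)).memLp (by simp), ?_, hsum, hpos, hb, hlim⟩
    -- Γ(2H+1) = 2H Γ(2H) absorbs the factor 1/2.
    rw [hρ, Int.cast_zero, SubFracOU.statCov_zero hθ (by linarith) (by linarith),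
      SubFracOU.limitVar, Real.Gamma_add_one (by linarith)]
    field_simp
  · rintro rfl
    obtain ⟨C, hC, hbound⟩ := SubFracOU.exists_log_bound hθ
    refine ⟨C, hC, fun Ω _ μ _ S X hS hX => ?_⟩
    obtain ⟨M, hM, hXM⟩ := (hX.gaussian hθ hS).1
    have hb (n : ℕ) (hn : 2 ≤ n) :
        |SubFracOU.quadVarVariance X μ n / Real.log n - 9 / (16 * θ ^ 4)| ≤
          C * (Real.log n)⁻¹ := by
      have hlog : 0 < Real.log n := Real.log_pos (by exact_mod_cast (show 1 < n by omega))
      have h := hbound n (by omega)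
      rw [show (3 / 2 : ℝ) = 2 * (3 / 4) by norm_num,
        ← hX.quadVarVariance_eq hθ (by norm_num) (by norm_num) hS] at h
      rw [div_sub' hlog.ne', abs_div, abs_of_pos hlog, div_eq_mul_inv, mul_comm (Real.log n)]
      exact mul_le_mul_of_nonneg_right h (inv_nonneg.2 hlog.le)
    refine ⟨fun t => (hM _ (hXM t)).memLp (by simp), hM.memLp_quadVar hXM, hb, ?_⟩
    rw [tendsto_iff_norm_sub_tendsto_zero]
    have h1 : Tendsto (fun n : ℕ => C * (Real.log n)⁻¹) atTop (𝓝 0) := by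
      simpa using ((Real.tendsto_log_atTop.comp
        tendsto_natCast_atTop_atTop).inv_tendsto_atTop).const_mul C
    refine squeeze_zero' (Eventually.of_forall fun n => norm_nonneg _) ?_ h1
    filter_upwards [eventually_ge_atTop 2] with n hn using hb n hn
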